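/- **Network.** Let $V$ be a finite set of nodes. An oblivious network model $M$ on $V$ is a random sequence $E_1,E_2,\dots\subseteq V\times V$ of active edge sets, where $E_t$ depends only on $t$, on the sets $E_{t'}$ with $t'<t$ and on private randomness, so the sequence is independent of the data and of the choices of the coding scheme. For $v\in V$ and $p\in[0,1]$ the flooding process $F(M,p,\{v\})$ is given by $S_1=\{v\}$ and $S_{t+1}=S_t\cup\{w:\exists u\in S_t,\ (u,w)\in E'_t\}$, where $E'_t$ arises from $E_t$ by keeping every directed edge independently with probability $1-p$; let $S_F$ be the first $t$ with $S_t=V$ (or $\infty$). $M$ floods in time $T$ with throughput $\alpha>0$ if there is a prime power $q$ such that $P[S_{F(M,1/q,\{v\})}\ge T+k]<q^{-\alpha k}$ for all $v\in V$ and all real $k>0$. Fix such $M,T,\alpha,q$ and let $\mathbb F_q$ be the field with $q$ elements. **Sources.** Let $X_1,X_2$ be arbitrarily correlated random variables with countable alphabets and finite joint entropy (in bits), and let $x_1,x_2$ be formed by $l$ i.i.d. samples of $(X_1,X_2)$. Each $x_i$ is given to an arbitrary non-empty set of nodes; nodes have no side information. **Scheme.** Fix a slack $\delta>0$ and a packet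 size of $s=b\log_2 q$ bits, with $b\ge1$ an integer. Each $x_i$ is put, by a uniformly random map that is known to all nodes, into one of $\lceil 2^{l(H(X_i)+\delta)}\rceil$ bins. Bins are labelled injectively (in any way) by vectors in $\mathbb F_q^{h_i}$, $h_i=\lceil \frac{l}{\log_2 q}(H(X_i)+\delta)\rceil$, and the label of the bin of $x_i$ is cut into $\lceil h_i/b\rceil$ blocks of $b$ symbols, the last one padded by zeros. The nodes holding $x_i$ initially store its blocks. In each round $t$, along each edge $(u,w)\in E_t$, node $w$ receives from $u$ a packet that is a random linear combination, with independent uniform coefficients in $\mathbb F_q$ drawn anew for each active edge, of all blocks and packets that $u$ has stored before the round. Each packet carries in its header its coefficients with respect to the blocks; the header is not counted in $s$. **Theorem.** Let $\epsilon>0$. For every sufficiently large $l$ (how large does not depend on the packet size, on the labelling, or on which nodes hold the messages) there is a decoding function, the same for all nodes, which takes the two binning maps and the set of all packets a node has stored, such that for every integer $$N\ \ge\ T+\frac1\alpha\left(\left\lceil\frac ls\bigl(H(X_1,X_2)+2\delta\bigr)\right\rceil+\log_2\epsilon^{-1}+3\right),$$ with probability at least $1-\epsilon$ every node decodes both $x_1$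 and $x_2$ correctly after $N$ rounds. -/

import Mathlib

open MeasureTheory ProbabilityTheory

namespace NetGossip

noncomputable section

/-! ### Oblivious network models and flooding -/

/-- An oblivious network model on the node set `V`: a law for the sequence of active edge sets.
The entry with index `t : ℕ` of the sequence is the set of directed edges that are active in the
`(t + 1)`-st round. The active edge set of a round may depend in an arbitrary way on the round, on
the earlier active edge sets and on private randomness, but on nothing else; this is the same as
giving the joint law of the sequence, which is then sampled independently of everything else. -/
structure ObliviousModel (V : Type*) where
  law : Measure (ℕ → Set (V × V))
  isProbabilityMeasure_law : IsProbabilityMeasure law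

instance {V : Type*} (M : ObliviousModel V) : IsProbabilityMeasure M.law :=
  M.isProbabilityMeasure_law

/-- The nodes informed after `n` rounds if the nodes of `S` are informed initially and every
informed node informs its out-neighbours in the edge set of the round. -/
def flood {V : Type*} (S : Set V) (E : ℕ → Set (V × V)) : ℕ → Set V
  | 0 => S
  | n + 1 => {v | ∃ u ∈ flood S E n, (u, v) ∈ E n ∨ v = u}

/-- The edges that survive when the transmissions marked by `fault` are deleted. -/
def thin {V : Type*} (E : ℕ → Set (V × V)) (fault : ℕ × V × V → Bool) : ℕ → Set (V × V) :=
  fun t => {e | e ∈ E t ∧ fault (t, e) = false}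

/-- Independent faults, each of probability `p`, for all rounds and all directed edges. -/
def faultLaw (V : Type*) (p : unitInterval) : Measure (ℕ × V × V → Bool) :=
  Measure.infinitePi fun _ => bernoulliMeasure true false p

/-- The event that the stopping time of the flooding process started in `S` is at least `a`.
The process `S₁ ⊆ S₂ ⊆ …` has `S₁ = S`, so `S_t` is the set informed after `t - 1` rounds, and the
stopping time is the first index `t` with `S_t = V` (infinite if there is none). -/
def stopsNotBefore {V : Type*} (S : Set V) (a : ℝ) :
    Set ((ℕ → Set (V × V)) × (ℕ × V × V → Bool)) :=
  {ω | ∀ t : ℕ, 1 ≤ t → flood S (thin ω.1 ω.2) (t - 1) = Set.univ → a ≤ t}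

/-- The fault probability `1 / q`. -/
def invProb (q : ℕ) : unitInterval :=
  ⟨(q : ℝ)⁻¹, inv_nonneg.mpr q.cast_nonneg, Nat.cast_inv_le_one q⟩

/-- `M` floods in time `T` with throughput `α`, and the prime power `q` achieves these parameters:
from every node the flooding process with fault probability `1 / q` has
`P[S_F ≥ T + k] < q ^ (- α k)` for every `k > 0`. -/
def ObliviousModel.FloodsWith {V : Type*} (M : ObliviousModel V) (T α : ℝ) (q : ℕ) : Prop :=
  IsPrimePow q ∧ ∀ v : V, ∀ k : ℝ, 0 < k →
    (M.law.prod (faultLaw V (invProb q))).real (stopsNotBefore {v} (T + k)) < (q : ℝ) ^ (-(α * k))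

/-! ### Entropy and random binning -/

/-- Shannon entropy, in bits, of a law on a countable alphabet. -/
def entropy {A : Type*} [MeasurableSpace A] (P : Measure A) : ℝ :=
  (∑' a, Real.negMulLog (P.real {a})) / Real.log 2

/-- The series that defines the entropy converges. -/
def FiniteEntropy {A : Type*} [MeasurableSpace A] (P : Measure A) : Prop :=
  Summable fun a => Real.negMulLog (P.real {a})

/-- The number `2 ^ (l (H + δ))` of bins, rounded up. -/
def numBins (l : ℕ) (H δ : ℝ) : ℕ := ⌈(2 : ℝ) ^ ((l : ℝ) * (H + δ))⌉₊

/-- The number of symbols of the field with `q` elements used for a bin index. -/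
def indexLength (q l : ℕ) (H δ : ℝ) : ℕ := ⌈(l : ℝ) / Real.logb 2 q * (H + δ)⌉₊

/-- The binning maps, one for every message. -/
abbrev Codebook {ι : Type*} (𝒳 : ι → Type*) (l : ℕ) (K : ι → ℕ) :=
  ∀ i, (Fin l → 𝒳 i) → Fin (K i)

/-- Random binning: independently for all messages and all sequences, the bin is uniform. -/
def codebookLaw {ι : Type*} [Fintype ι] (𝒳 : ι → Type*) (l : ℕ) (K : ι → ℕ) :
    Measure (Codebook 𝒳 l K) :=
  Measure.pi fun i => Measure.infinitePi fun _ : Fin l → 𝒳 i => uniformOn (Set.univ : Set (Fin (K i)))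

/-! ### The random linear network coding protocol -/

/-- The blocks: message `i` has a bin index of `h i` symbols, cut into blocks of `b` symbols. -/
abbrev Block {ι : Type*} (h : ι → ℕ) (b : ℕ) := Σ i, Fin ⌈(h i : ℝ) / b⌉₊

/-- A packet: one coefficient for each block (the header), and a linear combination of blocks. -/
abbrev Packet {ι : Type*} (F : Type*) (h : ι → ℕ) (b : ℕ) := (Block h b → F) × (Fin b → F)

section Protocol

variable {V ι F : Type*} [Fintype V] [Fintype ι] [Field F] {h : ι → ℕ} {b : ℕ}

/-- The content of a block of the bin indices `y`; the last block of a message is padded by zeros. -/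
def blockContent (y : ∀ i, Fin (h i) → F) (j : Block h b) : Fin b → F := fun r =>
  if hr : (j.2 : ℕ) * b + r < h j.1 then y j.1 ⟨(j.2 : ℕ) * b + r, hr⟩ else 0

open Classical in
/-- The block `j` together with its coefficient vector, a unit vector. -/
def initPacket (y : ∀ i, Fin (h i) → F) (j : Block h b) : Packet F h b :=
  (Pi.single j 1, blockContent y j)

/-- The coefficients of all random linear combinations: for a round, a directed edge and an item
that the tail of the edge may have stored, that is, an own block or the packet received in an
earlier round from some node. -/
abbrev Coeffs (V F : Type*) {ι : Type*} (h : ι → ℕ) (b : ℕ) :=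
  ℕ × (V × V) × (Block h b ⊕ ℕ × V) → F

/-- The coefficients are independent and uniform. -/
def coeffLaw (V F : Type*) {ι : Type*} [MeasurableSpace F] (h : ι → ℕ) (b : ℕ) :
    Measure (Coeffs V F h b) :=
  Measure.infinitePi fun _ => uniformOn (Set.univ : Set F)

open Classical in
/-- The packet transmitted along the edge `e` in the round with index `t` (if `e` is active then): a
random linear combination of everything that the tail of `e` has stored before that round, namely
its own blocks (`src i` is the set of nodes that are given message `i`) and all packets received
so far. -/
def transmitted (E : ℕ → Set (V × V)) (src : ι → Set V) (c : Coeffs V F h b)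
    (y : ∀ i, Fin (h i) → F) (t : ℕ) (e : V × V) : Packet F h b :=
  (∑ j : Block h b, if e.1 ∈ src j.1 then c (t, e, Sum.inl j) • initPacket y j else 0) +
    ∑ r : Fin t, ∑ w : V, if (w, e.1) ∈ E r then
      c (t, e, Sum.inr ((r : ℕ), w)) • transmitted E src c y r (w, e.1) else 0
termination_by t
decreasing_by exact r.2

/-- Everything that node `v` has stored after `N` rounds. -/
def stored (E : ℕ → Set (V × V)) (src : ι → Set V) (c : Coeffs V F h b)
    (y : ∀ i, Fin (h i) → F) (N : ℕ) (v : V) : Set (Packet F h b) :=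
  {p | (∃ j : Block h b, v ∈ src j.1 ∧ p = initPacket y j) ∨
    ∃ t < N, ∃ w : V, (w, v) ∈ E t ∧ p = transmitted E src c y t (w, v)}

end Protocol

/-- All random objects: active edge sets, coefficients, the `l` samples of the messages, and the
binning maps. -/
abbrev Outcome (V F : Type*) {ι : Type*} (𝒳 : ι → Type*) (l : ℕ) (K h : ι → ℕ) (b : ℕ) :=
  (ℕ → Set (V × V)) × Coeffs V F h b × (Fin l → ∀ i, 𝒳 i) × Codebook 𝒳 l K

/-- The joint law: the network, the coefficients, the `l` i.i.d. samples of `P` and the binning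
maps are independent. -/
def outcomeLaw {V : Type*} (M : ObliviousModel V) (F : Type*) [MeasurableSpace F]
    {ι : Type*} [Fintype ι] {𝒳 : ι → Type*} [∀ i, MeasurableSpace (𝒳 i)] (P : Measure (∀ i, 𝒳 i))
    (l : ℕ) (K h : ι → ℕ) (b : ℕ) : Measure (Outcome V F 𝒳 l K h b) :=
  M.law.prod ((coeffLaw V F h b).prod
    ((Measure.pi fun _ : Fin l => P).prod (codebookLaw 𝒳 l K)))

/-- A decoder estimates the message vectors from the binning maps and a set of packets. -/
abbrev Decoder (F : Type*) {ι : Type*} (𝒳 : ι → Type*) (l : ℕ) (K h : ι → ℕ) (b : ℕ) :=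
  Codebook 𝒳 l K → Set (Packet F h b) → (Fin l → ∀ i, 𝒳 i)

/-- The event that the decoder `D`, applied after `N` rounds to the packets stored at a node,
outputs all message vectors correctly at every node. The bins of message `i` are read as vectors
of length `h i` over `F` through the labelling `lab i`. -/
def allDecode {V F ι : Type*} [Fintype V] [Fintype ι] [Field F] {𝒳 : ι → Type*} {l : ℕ}
    {K h : ι → ℕ} {b : ℕ} (src : ι → Set V) (lab : ∀ i, Fin (K i) ↪ (Fin (h i) → F))
    (D : Decoder F 𝒳 l K h b) (N : ℕ) : Set (Outcome V F 𝒳 l K h b) :=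
  {ω | ∀ v : V, D ω.2.2.2 (stored ω.1 src ω.2.1
    (fun i => lab i (ω.2.2.2 i fun n => ω.2.2.1 n i)) N v) = ω.2.2.1}

end

end NetGossip

namespace NetGossip

noncomputable section

/-! ### Measurability of finitely determined maps, and shift invariance of uniform coefficients -/

/-! Say that a node knows a coefficient vector μ once it has stored a header not orthogonal to μ. A
packet sent by a node that knows μ is orthogonal to μ with probability exactly 1/q, independently of
the other transmissions up to that round. Hence, for a fixed edge sequence, knowledge of μ spreads
at least as fast as a flood with independent faults of probability 1/q, started at a holder of a
block where μ is nonzero (`flood_subset_knows`, `coeffLaw_map_coupledFault`). Put R = ⌈l/s (H(X₁,X₂)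
+ 2δ)⌉ and let B be the blind spot, the union over all nodes of the orthogonal complements of their
headers. Flooding with k = (R + log₂ ε⁻¹ + 3)/α puts a fixed μ ≠ 0 in B with probability at most ε
q^{-(R+3)} (`measure_mem_blindSpot_le`). A complete flood serves every node, so no union bound over
nodes is paid.

The decoder returns any typical sequence that explains the packets. Packets are linear in their
headers, so an error on a typical x produces a typical x' ≠ x for which all b columns of the
difference of the block arrays lie in B (`exists_confusable_of_decoding_error`). B depends only on
the network and the coefficients, hence is independent of samples and binning and can be fixed
first.

Let A be the nonempty set of messages where x and x' differ. Outside an event of probability 3ε/4,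
either B has no nonzero vector supported on the blocks of A, or at most q^{Σ_A h_i - bR} arrays have
all columns in B (`prob_not_fewSolutions_le`). The second bound uses Markov for the mean of the
normalised column counts and AM-GM for their product; a union bound over the b columns would cost a
factor b. As q^{h_i} is at most q times the number of bins, a pair is confused with probability at
most q² 2^{-l(H(X₁,X₂) - Σ_{i∉A} H(X_i) + δ)}, while only 2^{l(H(X₁,X₂) - Σ_{i∉A} H(X_i) + δ/2)}
typical x' compete. The sum is at most ε/8 for large l, uniformly in b
(`codebookLaw_exists_confusable_le`); the remaining ε/8 pays for atypical samples. -/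

theorem measurable_of_factors {Ω D X : Type*} [MeasurableSpace Ω] [MeasurableSpace D]
    [DiscreteMeasurableSpace D] [MeasurableSpace X] {g : Ω → D} (hg : Measurable g) {f : Ω → X}
    (hf : ∀ a a', g a = g a' → f a = f a') : Measurable f := by
  intro s _
  have : f ⁻¹' s = g ⁻¹' (g '' (f ⁻¹' s)) := by
    ext a
    constructor
    · exact fun ha => ⟨a, ha, rfl⟩
    · rintro ⟨a', ha', h⟩
      change f a ∈ s
      rw [← hf _ _ h]
      exact ha'
  rw [this]
  exact hg .of_discrete

instance isProbabilityMeasure_uniformOn_univ (A : Type*) [Finite A] [Nonempty A]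
    [MeasurableSpace A] [MeasurableSingletonClass A] :
    IsProbabilityMeasure (uniformOn (Set.univ : Set A)) :=
  isProbabilityMeasure_uniformOn Set.finite_univ Set.univ_nonempty

theorem uniformOn_univ_map_equiv {A : Type*} [Finite A] [MeasurableSpace A]
    [MeasurableSingletonClass A] (e : A ≃ A) :
    (uniformOn (Set.univ : Set A)).map e = uniformOn Set.univ := by
  have := Fintype.ofFinite A
  ext s _
  rw [Measure.map_apply .of_discrete .of_discrete, uniformOn_univ, uniformOn_univ,
    Measure.count_apply .of_discrete, Measure.count_apply .of_discrete,
    ← Equiv.image_symm_eq_preimage, e.symm.injective.encard_image]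

section Shift

variable {J F : Type*} [DecidableEq J] [Field F] [Finite F] [MeasurableSpace F]
  [MeasurableSingletonClass F]

theorem measurePreserving_add_single (j : J) (z : F) :
    MeasurePreserving (fun c : J → F => c + Pi.single j z)
      (Measure.infinitePi fun _ => uniformOn (Set.univ : Set F))
      (Measure.infinitePi fun _ => uniformOn (Set.univ : Set F)) := by
  have h := Measure.infinitePi_map_pi (fun _ : J => uniformOn (Set.univ : Set F))
    (f := fun i x => x + (Pi.single j z : J → F) i) (fun _ => .of_discrete)
  refine ⟨measurable_pi_lambda _ fun i =>
    Measurable.of_discrete (f := fun x => x + (Pi.single j z : J → F) i) |>.comp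
      (measurable_pi_apply i), ?_⟩
  refine Eq.trans ?_ (h.trans ?_)
  · rfl
  · congr 1
    funext i
    exact uniformOn_univ_map_equiv (Equiv.addRight ((Pi.single j z : J → F) i))

/-- Translating coordinate j by z preserves the measure and moves X by z κ. As κ ≠ 0 on A, the sets
{X = z κ}, z ∈ F, partition A into card F translates of {X = 0}. -/
theorem card_mul_measure_inter_zero (j : J) {A : Set (J → F)} (hA : MeasurableSet A)
    {X κ : (J → F) → F} (hX : Measurable X) (hκ : Measurable κ)
    (hAs : ∀ c z, c + Pi.single j z ∈ A ↔ c ∈ A)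
    (hXs : ∀ c ∈ A, ∀ z, X (c + Pi.single j z) = X c + z * κ c)
    (hκs : ∀ c ∈ A, ∀ z, κ (c + Pi.single j z) = κ c) (hκ0 : ∀ c ∈ A, κ c ≠ 0) :
    (Nat.card F : ENNReal) *
      (Measure.infinitePi fun _ => uniformOn (Set.univ : Set F)) (A ∩ {c | X c = 0}) =
      (Measure.infinitePi fun _ => uniformOn (Set.univ : Set F)) A := by
  have := Fintype.ofFinite F
  set μ := Measure.infinitePi fun _ : J => uniformOn (Set.univ : Set F)
  have hm : ∀ z, MeasurableSet (A ∩ {c | X c = z * κ c}) := fun z =>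
    hA.inter (measurableSet_eq_fun hX
      ((Measurable.of_discrete (f := fun x : F => z * x)).comp hκ))
  have hz : ∀ z, μ (A ∩ {c | X c = z * κ c}) = μ (A ∩ {c | X c = 0}) := by
    intro z
    rw [← (measurePreserving_add_single j z).measure_preimage (hm z).nullMeasurableSet]
    congr 1
    ext c
    simp only [Set.mem_preimage, Set.mem_inter_iff, hAs, Set.mem_ofPred_eq]
    refine and_congr_right fun hc => ?_
    rw [hXs c hc, hκs c hc]
    simp
  have hU : A = ⋃ z, A ∩ {c | X c = z * κ c} := by
    ext c
    simp only [Set.mem_iUnion, Set.mem_inter_iff, Set.mem_ofPred_eq]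
    refine ⟨fun hc => ⟨X c / κ c, hc, ?_⟩, fun ⟨_, hc, _⟩ => hc⟩
    rw [div_mul_cancel₀ _ (hκ0 c hc)]
  conv_rhs => rw [hU]
  rw [measure_iUnion _ hm, tsum_congr hz, tsum_fintype]
  · simp
  · intro z z' hne
    rw [Function.onFun, Set.disjoint_left]
    rintro c ⟨hc, h1⟩ ⟨-, h2⟩
    exact hne (mul_right_cancel₀ (hκ0 c hc) (h1.symm.trans h2))

/-- The coordinate to be shifted may be chosen from c itself, provided the shift does not alter the
choice: splitting by the value of p reduces to a fixed coordinate. -/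
theorem card_mul_measure_inter_zero_of_pivot [Countable J] {A : Set (J → F)}
    (hA : MeasurableSet A)
    {X κ : (J → F) → F} {p : (J → F) → J} (hX : Measurable X) (hκ : Measurable κ)
    (hp : ∀ j, MeasurableSet (p ⁻¹' {j}))
    (hps : ∀ c z, p (c + Pi.single (p c) z) = p c)
    (hAs : ∀ c z, c + Pi.single (p c) z ∈ A ↔ c ∈ A)
    (hXs : ∀ c z, X (c + Pi.single (p c) z) = X c + z * κ c)
    (hκs : ∀ c z, κ (c + Pi.single (p c) z) = κ c) (hκ0 : ∀ c, κ c ≠ 0) :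
    (Nat.card F : ENNReal) *
      (Measure.infinitePi fun _ => uniformOn (Set.univ : Set F)) (A ∩ {c | X c = 0}) =
      (Measure.infinitePi fun _ => uniformOn (Set.univ : Set F)) A := by
  set μ := Measure.infinitePi fun _ : J => uniformOn (Set.univ : Set F)
  have hsplit : ∀ B : Set (J → F), MeasurableSet B → μ B = ∑' j, μ (p ⁻¹' {j} ∩ B) := by
    intro B hB
    rw [← measure_iUnion _ fun j => (hp j).inter hB]
    · congr 1; ext c; simp
    · intro i j hij
      rw [Function.onFun, Set.disjoint_left]
      rintro c ⟨h1, -⟩ ⟨h2, -⟩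
      exact hij (h1.symm.trans h2)
  have hX0 : MeasurableSet {c | X c = 0} := hX (measurableSet_singleton 0)
  rw [hsplit _ (hA.inter hX0), hsplit A hA, ← ENNReal.tsum_mul_left]
  refine tsum_congr fun j => ?_
  rw [← Set.inter_assoc]
  have hpj : ∀ c z, p (c + Pi.single j z) = j ↔ p c = j := by
    intro c z
    constructor
    · intro h
      -- Undoing the shift gives the converse: a shifted point with pivot j comes from a point with
      -- pivot j.
      have := hps (c + Pi.single j z) (-z)
      rw [h, add_assoc, ← Pi.single_add] at this
      simpa using this
    · rintro rfl
      exact hps c z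
  refine card_mul_measure_inter_zero j ((hp j).inter hA) hX hκ ?_ ?_ ?_ fun c _ => hκ0 c
  · intro c z
    simp only [Set.mem_inter_iff, Set.mem_preimage, Set.mem_singleton_iff, hpj]
    refine and_congr_right ?_
    rintro rfl
    exact hAs c z
  · rintro c ⟨rfl, -⟩ z
    exact hXs c z
  · rintro c ⟨rfl, -⟩ z
    exact hκs c z

end Shift

/-! ### Headers determine packets, and knowledge spreads like a flood -/

section Knowledge

variable {V ι F : Type*} [Fintype V] [Fintype ι] [Field F] {h : ι → ℕ} {b : ℕ}

/-- The packet with header `a`, if the bin indices are `y`. -/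
def encode (y : ∀ i, Fin (h i) → F) (a : Block h b → F) : Packet F h b :=
  (a, ∑ j, a j • blockContent y j)

theorem encode_add (y : ∀ i, Fin (h i) → F) (a a' : Block h b → F) :
    encode y (a + a') = encode y a + encode y a' := by
  simp [encode, add_smul, Finset.sum_add_distrib]

theorem encode_smul (y : ∀ i, Fin (h i) → F) (z : F) (a : Block h b → F) :
    encode y (z • a) = z • encode y a := by
  simp [encode, mul_smul, Finset.smul_sum]

theorem encode_zero (y : ∀ i, Fin (h i) → F) : encode (b := b) y 0 = 0 := by
  simp [encode]

theorem encode_sum {κ : Type*} (y : ∀ i, Fin (h i) → F) (s : Finset κ)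
    (a : κ → Block h b → F) : encode y (∑ k ∈ s, a k) = ∑ k ∈ s, encode y (a k) := by
  classical
  induction s using Finset.induction_on with
  | empty => simp [encode_zero]
  | insert k s hk ih => rw [Finset.sum_insert hk, Finset.sum_insert hk, encode_add, ih]

theorem initPacket_eq_encode (y : ∀ i, Fin (h i) → F) (j : Block h b) :
    initPacket y j = encode y (initPacket (0 : ∀ i, Fin (h i) → F) j).1 := by
  classical
  refine Prod.ext (by simp [initPacket, encode]) ?_
  simp only [initPacket, encode]
  rw [Finset.sum_eq_single j]
  · simp
  · intro k _ hk
    simp [hk]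
  · simp

variable (E : ℕ → Set (V × V)) (src : ι → Set V)

theorem transmitted_eq_encode (c : Coeffs V F h b) (y : ∀ i, Fin (h i) → F) (t : ℕ)
    (e : V × V) :
    transmitted E src c y t e = encode y (transmitted E src c 0 t e).1 := by
  classical
  induction t using Nat.strong_induction_on generalizing e with
  | _ t ih =>
    rw [transmitted, transmitted, Prod.fst_add, Prod.fst_sum, Prod.fst_sum, encode_add,
      encode_sum, encode_sum]
    congr 1
    · refine Finset.sum_congr rfl fun j _ => ?_
      split_ifs
      · rw [Prod.smul_fst, encode_smul, ← initPacket_eq_encode]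
      · rw [Prod.fst_zero, encode_zero]
    · refine Finset.sum_congr rfl fun r _ => ?_
      rw [Prod.fst_sum, encode_sum]
      refine Finset.sum_congr rfl fun w _ => ?_
      split_ifs
      · rw [Prod.smul_fst, encode_smul, ih r r.2]
      · rw [Prod.fst_zero, encode_zero]

theorem stored_eq_image (c : Coeffs V F h b) (y : ∀ i, Fin (h i) → F) (N : ℕ) (v : V) :
    stored E src c y N v =
      encode y '' (Prod.fst '' stored E src c (0 : ∀ i, Fin (h i) → F) N v) := by
  ext p
  constructor
  · rintro (⟨j, hj, rfl⟩ | ⟨t, ht, w, hw, rfl⟩)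
    · exact ⟨_, ⟨_, Or.inl ⟨j, hj, rfl⟩, rfl⟩, (initPacket_eq_encode y j).symm⟩
    · exact ⟨_, ⟨_, Or.inr ⟨t, ht, w, hw, rfl⟩, rfl⟩,
        (transmitted_eq_encode E src c y t (w, v)).symm⟩
  · rintro ⟨_, ⟨_, ⟨j, hj, rfl⟩ | ⟨t, ht, w, hw, rfl⟩, rfl⟩, rfl⟩
    · exact Or.inl ⟨j, hj, (initPacket_eq_encode y j).symm⟩
    · exact Or.inr ⟨t, ht, w, hw, (transmitted_eq_encode E src c y t (w, v)).symm⟩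

/-- The vectors orthogonal to all headers stored at some node after `N` rounds. -/
def blindSpot (c : Coeffs V F h b) (N : ℕ) : Set (Block h b → F) :=
  {μ | ∃ v, ∀ p ∈ stored E src c (0 : ∀ i, Fin (h i) → F) N v, p.1 ⬝ᵥ μ = 0}

variable (μ : Block h b → F)

/-- The product of `μ` with the header sent along `e` in the round with index `t`. -/
def signal (c : Coeffs V F h b) (t : ℕ) (e : V × V) : F :=
  (transmitted E src c (0 : ∀ i, Fin (h i) → F) t e).1 ⬝ᵥ μ

open Classical in
/-- The products of `μ` with the headers of the items stored at `u` before the round with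
index `t`. -/
def gain (c : Coeffs V F h b) (t : ℕ) (u : V) : Block h b ⊕ ℕ × V → F
  | Sum.inl j => if u ∈ src j.1 then μ j else 0
  | Sum.inr (r, w) => if r < t ∧ (w, u) ∈ E r then signal E src μ c r (w, u) else 0

/-- The node `u` has stored a header that is not orthogonal to `μ`. -/
def Knows (c : Coeffs V F h b) (t : ℕ) (u : V) : Prop := ∃ x, gain E src μ c t u x ≠ 0

theorem signal_eq (c : Coeffs V F h b) (t : ℕ) (e : V × V) :
    signal E src μ c t e = ∑ x ∈ (Finset.univ.disjSum (Finset.range t ×ˢ Finset.univ) :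
      Finset (Block h b ⊕ ℕ × V)), c (t, e, x) * gain E src μ c t e.1 x := by
  classical
  rw [signal, transmitted, Prod.fst_add, Prod.fst_sum, Prod.fst_sum, add_dotProduct,
    sum_dotProduct, sum_dotProduct, Finset.sum_disjSum, Finset.sum_product,
    Finset.sum_range fun r => ∑ w : V, c (t, e, Sum.inr (r, w)) *
      gain E src μ c t e.1 (Sum.inr (r, w))]
  congr 1
  · refine Finset.sum_congr rfl fun j _ => ?_
    by_cases hj : e.1 ∈ src j.1 <;> simp [hj, gain, initPacket]
  · refine Finset.sum_congr rfl fun r _ => ?_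
    rw [Prod.fst_sum, sum_dotProduct]
    refine Finset.sum_congr rfl fun w _ => ?_
    by_cases hw : (w, e.1) ∈ E r <;> simp [hw, gain, signal]

theorem Knows.exists_mem_stored {c : Coeffs V F h b} {t : ℕ} {u : V}
    (hu : Knows E src μ c t u) :
    ∃ p ∈ stored E src c (0 : ∀ i, Fin (h i) → F) t u, p.1 ⬝ᵥ μ ≠ 0 := by
  classical
  obtain ⟨j | ⟨r, w⟩, hx⟩ := hu
  · simp only [gain, ne_eq, ite_eq_right_iff, not_forall] at hx
    exact ⟨_, Or.inl ⟨j, hx.1, rfl⟩, by simpa [initPacket] using hx.2⟩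
  · simp only [gain, ne_eq, ite_eq_right_iff, not_forall] at hx
    exact ⟨_, Or.inr ⟨r, hx.1.1, w, hx.1.2, rfl⟩, hx.2⟩

theorem Knows.succ {c : Coeffs V F h b} {t : ℕ} {u : V} (hu : Knows E src μ c t u) :
    Knows E src μ c (t + 1) u := by
  classical
  obtain ⟨j | ⟨r, w⟩, hx⟩ := hu
  · exact ⟨Sum.inl j, hx⟩
  · refine ⟨Sum.inr (r, w), ?_⟩
    simp only [gain, ne_eq, ite_eq_right_iff, not_forall] at hx ⊢
    exact ⟨⟨hx.1.1.trans (Nat.lt_succ_self t), hx.1.2⟩, hx.2⟩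

/-- The coefficients that can influence the packet sent along `e` in the round with index `t`. -/
def cone (h : ι → ℕ) (b : ℕ) (t : ℕ) (e : V × V) : Set (ℕ × (V × V) × (Block h b ⊕ ℕ × V)) :=
  {x | (x.1 < t ∨ x.1 = t ∧ x.2.1 = e) ∧ ∀ r w, x.2.2 = Sum.inr (r, w) → r < x.1}

/-- Items are indexed by arbitrary round numbers; finiteness comes from the clause of `cone` that
only items received before the sending round count. -/
theorem finite_cone (t : ℕ) (e : V × V) : (cone h b t e).Finite := by
  have : (Set.Iic t ×ˢ (Set.univ ×ˢ (Set.range Sum.inl ∪ Sum.inr '' (Set.Iio t ×ˢ Set.univ))) :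
      Set (ℕ × (V × V) × (Block h b ⊕ ℕ × V))).Finite :=
    (Set.finite_Iic t).prod (Set.finite_univ.prod
      ((Set.finite_range _).union (((Set.finite_Iio t).prod Set.finite_univ).image _)))
  refine this.subset ?_
  rintro ⟨t', e', j | ⟨r, w⟩⟩ ⟨h1, h2⟩
  · simp only [Set.mem_prod, Set.mem_Iic, Set.mem_univ, true_and]
    refine ⟨by simp only at h1; omega, by simp⟩
  · have := h2 r w rfl
    simp only [Set.mem_prod, Set.mem_Iic, Set.mem_univ, true_and]
    simp only at h1 this
    exact ⟨by omega, Or.inr ⟨(r, w), ⟨by simp; omega, by simp⟩, rfl⟩⟩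

theorem signal_congr {E E' : ℕ → Set (V × V)} {c c' : Coeffs V F h b} {t : ℕ} {e : V × V}
    (hE : ∀ r < t, E r = E' r) (hc : ∀ x ∈ cone h b t e, c x = c' x) :
    signal E src μ c t e = signal E' src μ c' t e := by
  classical
  induction t using Nat.strong_induction_on generalizing e with
  | _ t ih =>
    rw [signal_eq, signal_eq]
    refine Finset.sum_congr rfl fun x hx => ?_
    obtain j | ⟨r, w⟩ := x
    · rw [hc _ ⟨Or.inr ⟨rfl, rfl⟩, by simp⟩]
      rfl
    · have hr : r < t := by simpa using hx
      rw [hc _ ⟨Or.inr ⟨rfl, rfl⟩, fun r' w' h' => by simp at h'; simp; omega⟩]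
      simp only [gain, hE r hr]
      rw [ih r hr fun s hs => hE s (hs.trans hr)]
      rintro x ⟨hx1, hx2⟩
      exact hc x ⟨Or.inl (by omega), hx2⟩

theorem gain_congr {E E' : ℕ → Set (V × V)} {c c' : Coeffs V F h b} {t : ℕ} (u : V)
    (hE : ∀ r < t, E r = E' r) (hc : ∀ e, ∀ x ∈ cone h b t e, x.1 < t → c x = c' x) :
    gain E src μ c t u = gain E' src μ c' t u := by
  classical
  funext x
  obtain j | ⟨r, w⟩ := x
  · rfl
  · simp only [gain]
    by_cases hr : r < t
    · rw [hE r hr, signal_congr src μ (c' := c') fun s hs => hE s (hs.trans hr)]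
      rintro x ⟨hx1, hx2⟩
      exact hc (w, u) x ⟨Or.inl (by omega), hx2⟩ (by omega)
    · simp [hr]

open Classical in
/-- An item with nonzero value, if there is one. -/
def pivotOf {X : Type*} (g : X → F) (x₀ : X) : X :=
  if hg : ∃ x, g x ≠ 0 then hg.choose else x₀

open Classical in
/-- The nonzero value at the pivot. -/
def pivotGain {X : Type*} (g : X → F) (x₀ : X) : F :=
  if ∃ x, g x ≠ 0 then g (pivotOf g x₀) else 1

open Classical in
/-- The signal along `e` if the tail of `e` knows `μ`, a fresh coefficient otherwise. -/
def faultSignal (j₀ : Block h b) (c : Coeffs V F h b) (t : ℕ) (e : V × V) : F :=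
  if Knows E src μ c t e.1 then signal E src μ c t e else c (t, e, Sum.inl j₀)

open Classical in
/-- The faults of the flooding process to which the spreading of knowledge is compared. -/
def coupledFault (j₀ : Block h b) (c : Coeffs V F h b) : ℕ × V × V → Bool :=
  fun i => decide (faultSignal E src μ j₀ c i.1 i.2 = 0)

variable {E src μ}

theorem pivotGain_ne_zero {X : Type*} (g : X → F) (x₀ : X) : pivotGain g x₀ ≠ 0 := by
  classical
  by_cases hu : ∃ x, g x ≠ 0
  · simp only [pivotGain, pivotOf, hu, ↓reduceDIte, ↓reduceIte]
    exact hu.choose_spec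
  · simp [pivotGain, hu]

theorem faultSignal_congr {E' : ℕ → Set (V × V)} (j₀ : Block h b) {c c' : Coeffs V F h b}
    {t : ℕ} {e : V × V}
    (hE : ∀ r < t, E r = E' r) (hc : ∀ e', ∀ x ∈ cone h b t e', x.1 < t ∨ e' = e → c x = c' x) :
    faultSignal E src μ j₀ c t e = faultSignal E' src μ j₀ c' t e := by
  classical
  have hg := gain_congr src μ (c := c) (c' := c') e.1 hE fun e' x hx hxt => hc e' x hx (Or.inl hxt)
  have hk : Knows E src μ c t e.1 ↔ Knows E' src μ c' t e.1 := by rw [Knows, Knows, hg]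
  by_cases hK : Knows E src μ c t e.1
  · rw [faultSignal, faultSignal, if_pos hK, if_pos (hk.1 hK)]
    exact signal_congr src μ hE fun x hx => hc e x hx (Or.inr rfl)
  · rw [faultSignal, faultSignal, if_neg hK, if_neg (mt hk.2 hK)]
    exact hc e _ ⟨Or.inr ⟨rfl, rfl⟩, by simp⟩ (Or.inr rfl)

/-- If the tail knows μ, a transmission is declared faulty exactly when its header is orthogonal to
μ. So every fault-free step of the flood out of a knowing node hands over a header that is not
orthogonal to μ. -/
theorem flood_subset_knows {j₀ : Block h b} (hj₀ : μ j₀ ≠ 0) {v₀ : V} (hv₀ : v₀ ∈ src j₀.1)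
    (c : Coeffs V F h b) (n : ℕ) {v : V}
    (hv : v ∈ flood {v₀} (thin E (coupledFault E src μ j₀ c)) n) : Knows E src μ c n v := by
  classical
  induction n generalizing v with
  | zero =>
    obtain rfl : v = v₀ := hv
    exact ⟨Sum.inl j₀, by simpa [gain, hv₀] using hj₀⟩
  | succ n ih =>
    obtain ⟨u, hu, h1 | rfl⟩ := hv
    · obtain ⟨h2, h3⟩ := h1
      have hk := ih hu
      refine ⟨Sum.inr (n, u), ?_⟩
      simpa [coupledFault, faultSignal, hk, gain, h2] using h3
    · exact (ih hu).succ

theorem flood_ne_univ_of_mem_blindSpot {j₀ : Block h b} (hj₀ : μ j₀ ≠ 0) {v₀ : V}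
    (hv₀ : v₀ ∈ src j₀.1) {c : Coeffs V F h b} {N : ℕ} (hμ : μ ∈ blindSpot E src c N) :
    flood {v₀} (thin E (coupledFault E src μ j₀ c)) N ≠ Set.univ := by
  obtain ⟨v, hv⟩ := hμ
  intro hN
  obtain ⟨p, hp, hp0⟩ := (flood_subset_knows hj₀ hv₀ c N
    (hN ▸ Set.mem_univ v)).exists_mem_stored
  exact hp0 (hv p hp)

end Knowledge

/-! ### Finitely determined events -/

/-- Only finitely many coordinates with values in a finite field matter, so the σ-algebra on the
target is irrelevant. -/
theorem measurable_of_cone {V ι F : Type*} [Fintype V] [Fintype ι] [Finite F]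
    [MeasurableSpace F] [MeasurableSingletonClass F] {h : ι → ℕ} {b : ℕ} {X : Type*} [MeasurableSpace X] (t : ℕ) {f : Coeffs V F h b → X}
    (hf : ∀ c c', (∀ e, ∀ x ∈ cone h b t e, c x = c' x) → f c = f c') : Measurable f := by
  have hfin : (⋃ e, cone (V := V) h b t e).Finite := Set.finite_iUnion fun e => finite_cone t e
  have := hfin.to_subtype
  refine measurable_of_factors (g := fun c => fun x : (⋃ e, cone (V := V) h b t e) => c x)
    (by fun_prop) fun c c' hcc => hf c c' fun e x hx => ?_
  exact congrFun hcc ⟨x, Set.mem_iUnion.2 ⟨e, hx⟩⟩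

section Flood

variable {V : Type*}

theorem flood_congr {S : Set V} {E E' : ℕ → Set (V × V)} {N : ℕ} (hE : ∀ r < N, E r = E' r) :
    flood S E N = flood S E' N := by
  induction N with
  | zero => rfl
  | succ n ih =>
    ext v
    simp only [flood, ih fun r hr => hE r (hr.trans (Nat.lt_succ_self n)),
      hE n (Nat.lt_succ_self n)]

theorem flood_mono {S : Set V} {E : ℕ → Set (V × V)} {n m : ℕ} (hnm : n ≤ m) :
    flood S E n ⊆ flood S E m := by
  induction m, hnm using Nat.le_induction with
  | base => exact subset_rfl
  | succ m _ ih => exact fun v hv => ⟨v, ih hv, Or.inr rfl⟩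

theorem measurableSet_flood_ne_univ [Finite V] (S : Set V) (N : ℕ) :
    MeasurableSet {ω : (ℕ → Set (V × V)) × (ℕ × V × V → Bool) |
      flood S (thin ω.1 ω.2) N ≠ Set.univ} := by
  let _ : MeasurableSpace Prop := ⊤
  have : Measurable fun ω : (ℕ → Set (V × V)) × (ℕ × V × V → Bool) =>
      flood S (thin ω.1 ω.2) N ≠ Set.univ := by
    refine measurable_of_factors (g := fun ω : (ℕ → Set (V × V)) × (ℕ × V × V → Bool) =>
      ((fun t : Fin N => ω.1 t), fun x : Fin N × V × V => ω.2 (x.1, x.2)))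
      (by fun_prop) fun ω ω' hω => ?_
    rw [flood_congr (E' := thin ω'.1 ω'.2)]
    intro r hr
    ext e
    have h1 : ω.1 r = ω'.1 r := congrFun (congrArg Prod.fst hω) ⟨r, hr⟩
    have h2 : ω.2 (r, e) = ω'.2 (r, e) := congrFun (congrArg Prod.snd hω) (⟨r, hr⟩, e)
    simp [thin, h1, h2]
  exact this (MeasurableSpace.measurableSet_top (s := {True})) |> fun h => by
    simpa [Set.preimage] using h

end Flood

/-! ### The law of the coupled faults -/

section FaultLaw

variable {V ι F : Type*} [Fintype V] [Fintype ι] [Field F] {h : ι → ℕ} {b : ℕ}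
  {E : ℕ → Set (V × V)} {src : ι → Set V} {μ : Block h b → F}

open Classical in
theorem gain_add_single (c : Coeffs V F h b) (t : ℕ) (e : V × V) (x : Block h b ⊕ ℕ × V) (z : F)
    (u : V) :
    gain E src μ (c + Pi.single (t, e, x) z) t u = gain E src μ c t u :=
  gain_congr src μ u (fun _ _ => rfl) fun e' x' _ hx't => by
    have : x' ≠ (t, e, x) := by rintro rfl; exact lt_irrefl _ hx't
    simp [this]

open Classical in
-- A coefficient drawn for one transmission enters that packet and packets of later rounds only;
-- other faults of the same or earlier rounds cannot see it.
theorem faultSignal_add_single_of_ne (j₀ : Block h b) (c : Coeffs V F h b) {t t' : ℕ}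
    {e e' : V × V} (x : Block h b ⊕ ℕ × V) (z : F) (ht : t' ≤ t) (hne : (t', e') ≠ (t, e)) :
    faultSignal E src μ j₀ (c + Pi.single (t, e, x) z) t' e' = faultSignal E src μ j₀ c t' e' :=
  faultSignal_congr j₀ (fun _ _ => rfl) fun e'' x' hx' hx't => by
    have : x' ≠ (t, e, x) := by
      rintro rfl
      obtain ⟨h1 | ⟨h1, h2⟩, -⟩ := hx'
      · exact absurd h1 (not_lt.2 ht)
      · rcases hx't with h3 | rfl
        · exact absurd h3 (not_lt.2 ht)
        · exact hne (Prod.ext h1.symm h2.symm)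
    simp [this]

open Classical in
-- Each fault is decided by an expression affine in one fresh coefficient with nonzero slope: the
-- pivot's gain if the tail knows μ, and 1 in the default case. The default coin is needed because a
-- tail ignorant of μ always sends signal 0, which would spoil the fault law.
theorem faultSignal_add_single (j₀ : Block h b) (c : Coeffs V F h b) (t : ℕ) (e : V × V) (z : F) :
    faultSignal E src μ j₀
      (c + Pi.single (t, e, pivotOf (gain E src μ c t e.1) (Sum.inl j₀)) z) t e =
      faultSignal E src μ j₀ c t e + z * pivotGain (gain E src μ c t e.1) (Sum.inl j₀) := by
  set x := pivotOf (gain E src μ c t e.1) (Sum.inl j₀) with hx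
  have hg := gain_add_single (E := E) (src := src) (μ := μ) c t e x z e.1
  by_cases hk : Knows E src μ c t e.1
  · have hk' : Knows E src μ (c + Pi.single (t, e, x) z) t e.1 := by
      rwa [Knows, hg]
    have hk2 : ∃ x, gain E src μ c t e.1 x ≠ 0 := hk
    rw [faultSignal, faultSignal, if_pos hk, if_pos hk', pivotGain, if_pos hk2, ← hx,
      signal_eq, signal_eq, hg]
    have hx0 : gain E src μ c t e.1 x ≠ 0 := by
      rw [hx, pivotOf, dif_pos hk2]
      exact hk2.choose_spec
    have hxm : x ∈ (Finset.univ.disjSum (Finset.range t ×ˢ Finset.univ) :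
        Finset (Block h b ⊕ ℕ × V)) := by
      rcases hxx : x with j | ⟨r, w⟩
      · simp
      · rw [hxx] at hx0
        simp only [gain, ne_eq, ite_eq_right_iff, not_forall] at hx0
        simpa using hx0.1.1
    simp only [Pi.add_apply, add_mul, Finset.sum_add_distrib]
    congr 1
    rw [Finset.sum_eq_single_of_mem x hxm]
    · simp
    · intro y _ hy
      simp [hy]
  · have hk' : ¬ Knows E src μ (c + Pi.single (t, e, x) z) t e.1 := by
      rwa [Knows, hg]
    have hk2 : ¬ ∃ x, gain E src μ c t e.1 x ≠ 0 := hk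
    have hxj : x = Sum.inl j₀ := by rw [hx, pivotOf, dif_neg hk2]
    rw [faultSignal, faultSignal, if_neg hk, if_neg hk', pivotGain, if_neg hk2, hxj]
    simp

variable [Finite F] [MeasurableSpace F] [MeasurableSingletonClass F]

instance : IsProbabilityMeasure (coeffLaw V F h b) := by
  unfold coeffLaw; infer_instance

theorem measurable_faultSignal (j₀ : Block h b) (t : ℕ) (e : V × V) :
    Measurable fun c : Coeffs V F h b => faultSignal E src μ j₀ c t e :=
  measurable_of_cone t fun _ _ hc => faultSignal_congr j₀ (fun _ _ => rfl) fun e' x hx _ => hc e' x hx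

theorem measurable_coupledFault (j₀ : Block h b) :
    Measurable fun c : Coeffs V F h b => coupledFault E src μ j₀ c :=
  measurable_pi_lambda _ fun i => by
    classical
    exact (Measurable.of_discrete (f := fun x : F => decide (x = 0))).comp
      (measurable_faultSignal j₀ i.1 i.2)

theorem card_mul_coeffLaw_inter_fault (j₀ : Block h b) (t : ℕ) (e : V × V)
    {A : Set (Coeffs V F h b)} (hA : MeasurableSet A)
    (hAs : ∀ c x z, (by classical exact c + Pi.single (t, e, x) z ∈ A) ↔ c ∈ A) :
    (Nat.card F : ENNReal) * coeffLaw V F h b (A ∩ {c | faultSignal E src μ j₀ c t e = 0}) =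
      coeffLaw V F h b A := by
  classical
  have : Countable V := Finite.to_countable
  refine card_mul_measure_inter_zero_of_pivot hA
    (κ := fun c => pivotGain (gain E src μ c t e.1) (Sum.inl j₀))
    (p := fun c => (t, e, pivotOf (gain E src μ c t e.1) (Sum.inl j₀)))
    (measurable_faultSignal j₀ t e) ?_ ?_ ?_ ?_ ?_ ?_ ?_
  · refine measurable_of_cone t fun c c' hc => ?_
    rw [gain_congr src μ (E := E) (c := c) (c' := c') e.1 (fun _ _ => rfl)
      fun e x hx _ => hc e x hx]
  · intro j
    let _ : MeasurableSpace (ℕ × (V × V) × (Block h b ⊕ ℕ × V)) := ⊤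
    refine (measurable_of_cone (F := F) (X := ℕ × (V × V) × (Block h b ⊕ ℕ × V)) t
      fun c c' hc => ?_) (MeasurableSpace.measurableSet_top)
    rw [gain_congr src μ (E := E) (c := c) (c' := c') e.1 (fun _ _ => rfl)
      fun e x hx _ => hc e x hx]
  · intro c z
    rw [gain_add_single]
  · intro c z
    exact hAs c _ z
  · intro c z
    exact faultSignal_add_single j₀ c t e z
  · intro c z
    rw [gain_add_single]
  · intro c
    exact pivotGain_ne_zero _ _

/-- Given any event that ignores the coefficients of one transmission, its fault is still Bernoulli
with parameter 1/q. This is the independence needed to identify the joint law. -/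
theorem coeffLaw_inter_coupledFault (j₀ : Block h b) (i : ℕ × V × V)
    {A : Set (Coeffs V F h b)} (hA : MeasurableSet A)
    (hAs : ∀ c x z, (by classical exact c + Pi.single (i.1, i.2, x) z ∈ A) ↔ c ∈ A)
    (s : Set Bool) :
    coeffLaw V F h b (A ∩ {c | coupledFault E src μ j₀ c i ∈ s}) =
      coeffLaw V F h b A * bernoulliMeasure true false (invProb (Nat.card F)) s := by
  classical
  have hm : Measurable fun c : Coeffs V F h b => coupledFault E src μ j₀ c i :=
    (measurable_pi_apply i).comp (measurable_coupledFault j₀)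
  have hq0 : Nat.card F ≠ 0 := Nat.card_pos.ne'
  have hq : (Nat.card F : ENNReal) ≠ 0 := by simpa using hq0
  have hq' : (Nat.card F : ENNReal) ≠ ⊤ := by simp
  have hp : bernoulliMeasure true false (invProb (Nat.card F)) {true} =
      (Nat.card F : ENNReal)⁻¹ := by
    rw [bernoulliMeasure_apply _ (measurableSet_singleton _)]
    simp only [Set.mem_singleton_iff, ↓reduceIte, Bool.false_eq_true]
    rw [← ENNReal.coe_natCast, ← ENNReal.coe_inv (by simpa using hq0), ENNReal.coe_inj]
    ext
    simp [invProb]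
  have h1 : coeffLaw V F h b (A ∩ {c | coupledFault E src μ j₀ c i ∈ ({true} : Set Bool)}) =
      coeffLaw V F h b A * (Nat.card F : ENNReal)⁻¹ := by
    rw [← card_mul_coeffLaw_inter_fault (E := E) (src := src) (μ := μ) j₀ i.1 i.2 hA hAs, mul_comm,
      ← mul_assoc, ENNReal.inv_mul_cancel hq hq', one_mul]
    congr 2
    ext c
    simp [coupledFault]
  have key : ((coeffLaw V F h b).restrict A).map (fun c => coupledFault E src μ j₀ c i) =
      coeffLaw V F h b A • bernoulliMeasure true false (invProb (Nat.card F)) := by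
    refine Measure.ext_of_singleton fun x => ?_
    rw [Measure.map_apply hm (measurableSet_singleton _),
      Measure.restrict_apply (hm (measurableSet_singleton _)), Set.inter_comm,
      Measure.smul_apply, smul_eq_mul]
    cases x with
    | true => rw [hp]; exact h1
    | false =>
      have h2 : ({false} : Set Bool) = {true}ᶜ := by ext x; cases x <;> simp
      rw [h2, prob_compl_eq_one_sub (measurableSet_singleton _), hp, ENNReal.mul_sub (by simp),
        mul_one, ← h1, ← measure_inter_add_sdiff A (hm (measurableSet_singleton true))]
      exact (ENNReal.add_sub_cancel_left (measure_ne_top _ _)).symm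
  have := congrArg (fun ν => ν s) key
  rwa [Measure.map_apply hm .of_discrete, Measure.restrict_apply (hm .of_discrete), Set.inter_comm,
    Measure.smul_apply, smul_eq_mul] at this

theorem coeffLaw_map_coupledFault (j₀ : Block h b) :
    (coeffLaw V F h b).map (fun c => coupledFault E src μ j₀ c) =
      faultLaw V (invProb (Nat.card F)) := by
  classical
  refine Measure.eq_infinitePi _ fun s t ht => ?_
  have hms : ∀ s : Finset (ℕ × V × V), MeasurableSet (Set.pi (s : Set (ℕ × V × V)) t) :=
    fun s => .pi s.countable_toSet fun i _ => ht i
  rw [Measure.map_apply (measurable_coupledFault j₀) (hms s)]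
  -- Peeling off an index of the latest round leaves faults of rounds no later than it, and these do
  -- not depend on its coefficients.
  induction s using Finset.induction_on_max_value (fun i : ℕ × V × V => i.1) with
  | empty => simp
  | insert i s hi hmax ih =>
    rw [Finset.prod_insert hi, ← ih, mul_comm, ← coeffLaw_inter_coupledFault (E := E) (src := src)
      (μ := μ) j₀ i (measurable_coupledFault j₀ (hms s)) ?_ (t i)]
    · congr 1
      ext c
      simp [and_comm]
    · intro c x z
      simp only [Set.mem_preimage, Set.mem_pi]
      refine forall₂_congr fun j hj => ?_
      have hne : (j.1, j.2) ≠ (i.1, i.2) := by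
        intro hji
        exact hi ((show j = i from hji) ▸ hj)
      simp only [coupledFault, faultSignal_add_single_of_ne j₀ c x z (hmax j hj) hne]

end FaultLaw

/-! ### The probability that a vector stays unknown -/

section BlindSpot

variable {V ι F : Type*} [Fintype V] [Fintype ι] [Field F] {h : ι → ℕ} {b : ℕ}

theorem transmitted_congr {E E' : ℕ → Set (V × V)} (src : ι → Set V) {c c' : Coeffs V F h b}
    {t : ℕ} (e : V × V) (hE : ∀ r < t, E r = E' r) (hc : ∀ x ∈ cone h b t e, c x = c' x) :
    (transmitted E src c (0 : ∀ i, Fin (h i) → F) t e).1 =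
      (transmitted E' src c' (0 : ∀ i, Fin (h i) → F) t e).1 := by
  classical
  funext j
  -- Testing against unit vectors recovers the header coordinate by coordinate.
  have := signal_congr src (Pi.single j (1 : F)) hE hc
  simpa [signal] using this

theorem blindSpot_congr {E E' : ℕ → Set (V × V)} (src : ι → Set V) {c c' : Coeffs V F h b}
    {N : ℕ} (hE : ∀ r < N, E r = E' r) (hc : ∀ t < N, ∀ e, ∀ x ∈ cone h b t e, c x = c' x) :
    blindSpot E src c N = blindSpot E' src c' N := by
  have hs : ∀ v, Prod.fst '' stored E src c (0 : ∀ i, Fin (h i) → F) N v =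
      Prod.fst '' stored E' src c' (0 : ∀ i, Fin (h i) → F) N v := by
    intro v
    have ht : ∀ t < N, ∀ w, (transmitted E src c (0 : ∀ i, Fin (h i) → F) t (w, v)).1 =
        (transmitted E' src c' (0 : ∀ i, Fin (h i) → F) t (w, v)).1 := fun t ht w =>
      transmitted_congr src _ (fun r hr => hE r (hr.trans ht)) (hc t ht _)
    ext a
    constructor
    · rintro ⟨_, ⟨j, hj, rfl⟩ | ⟨t, htN, w, hw, rfl⟩, rfl⟩
      · exact ⟨_, Or.inl ⟨j, hj, rfl⟩, rfl⟩
      · exact ⟨_, Or.inr ⟨t, htN, w, hE t htN ▸ hw, rfl⟩, (ht t htN w).symm⟩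
    · rintro ⟨_, ⟨j, hj, rfl⟩ | ⟨t, htN, w, hw, rfl⟩, rfl⟩
      · exact ⟨_, Or.inl ⟨j, hj, rfl⟩, rfl⟩
      · exact ⟨_, Or.inr ⟨t, htN, w, (hE t htN).symm ▸ hw, rfl⟩, ht t htN w⟩
  ext μ
  simp only [blindSpot, Set.mem_ofPred_eq]
  refine exists_congr fun v => ?_
  rw [← Set.forall_mem_image (f := Prod.fst) (p := fun a => a ⬝ᵥ μ = 0),
    ← Set.forall_mem_image (f := Prod.fst) (p := fun a => a ⬝ᵥ μ = 0), hs v]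

variable [Finite F] [MeasurableSpace F] [MeasurableSingletonClass F]

theorem measurable_blindSpot (src : ι → Set V) (N : ℕ) {X : Type*} [MeasurableSpace X]
    (f : Set (Block h b → F) → X) :
    Measurable fun ω : (ℕ → Set (V × V)) × Coeffs V F h b => f (blindSpot ω.1 src ω.2 N) := by
  have hfin : (⋃ t : Fin N, ⋃ e, cone (V := V) h b t e).Finite :=
    Set.finite_iUnion fun t => Set.finite_iUnion fun e => finite_cone t e
  have := hfin.to_subtype
  refine measurable_of_factors (g := fun ω : (ℕ → Set (V × V)) × Coeffs V F h b =>
    ((fun t : Fin N => ω.1 t), fun x : (⋃ t : Fin N, ⋃ e, cone (V := V) h b t e) => ω.2 x))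
    (by fun_prop) fun ω ω' hω => ?_
  rw [blindSpot_congr src]
  · exact fun r hr => congrFun (congrArg Prod.fst hω) ⟨r, hr⟩
  · exact fun t ht e x hx => congrFun (congrArg Prod.snd hω)
      ⟨x, Set.mem_iUnion.2 ⟨⟨t, ht⟩, Set.mem_iUnion.2 ⟨e, hx⟩⟩⟩

/-- The coefficients are independent of the network, so the edge sequence can be fixed by Fubini and
the blind event compared with the flood section by section. -/
theorem measure_mem_blindSpot_le (M : ObliviousModel V) {T α : ℝ}
    (hM : M.FloodsWith T α (Nat.card F)) {src : ι → Set V} (hsrc : ∀ i, (src i).Nonempty)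
    {μ : Block h b → F} (hμ : μ ≠ 0) {k : ℝ} (hk : 0 < k) {N : ℕ} (hN : T + k ≤ N) :
    (M.law.prod (coeffLaw V F h b)).real {ω | μ ∈ blindSpot ω.1 src ω.2 N} ≤
      (Nat.card F : ℝ) ^ (-(α * k)) := by
  obtain ⟨j₀, hj₀⟩ := Function.ne_iff.1 hμ
  obtain ⟨v₀, hv₀⟩ := hsrc j₀.1
  refine le_trans ?_ (hM.2 v₀ k hk).le
  have : IsProbabilityMeasure (faultLaw V (invProb (Nat.card F))) := by
    unfold faultLaw; infer_instance
  refine ENNReal.toReal_mono (measure_ne_top _ _) ?_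
  calc (M.law.prod (coeffLaw V F h b)) {ω | μ ∈ blindSpot ω.1 src ω.2 N}
      = ∫⁻ E, coeffLaw V F h b {c | μ ∈ blindSpot E src c N} ∂M.law := by
        rw [Measure.prod_apply]
        · rfl
        · exact measurableSet_setOfPred.2 (measurable_blindSpot src N fun B => μ ∈ B)
    _ ≤ ∫⁻ E, faultLaw V (invProb (Nat.card F)) {f | flood {v₀} (thin E f) N ≠ Set.univ} ∂M.law := by
        refine lintegral_mono fun E => ?_
        have hm : MeasurableSet {f : ℕ × V × V → Bool | flood {v₀} (thin E f) N ≠ Set.univ} :=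
          measurable_prodMk_left (x := E) (measurableSet_flood_ne_univ {v₀} N)
        rw [← coeffLaw_map_coupledFault (E := E) (src := src) (μ := μ) j₀,
          Measure.map_apply (measurable_coupledFault j₀) hm]
        exact measure_mono fun c hc => flood_ne_univ_of_mem_blindSpot hj₀ hv₀ hc
    _ = (M.law.prod (faultLaw V (invProb (Nat.card F))))
          {ω | flood {v₀} (thin ω.1 ω.2) N ≠ Set.univ} := by
        rw [Measure.prod_apply (measurableSet_flood_ne_univ {v₀} N)]
        rfl
    _ ≤ _ := by
        -- The stopping index t refers to t - 1 rounds, so an incomplete flood after N rounds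
        -- excludes every t ≤ N.
        refine measure_mono fun ω hω t ht htU => hN.trans ?_
        by_contra hlt
        push Not at hlt
        have : t ≤ N := by exact_mod_cast hlt.le
        exact hω (Set.univ_subset_iff.1 (htU ▸ flood_mono (by omega)))

end BlindSpot

/-! ### Random sets of vectors -/

/-- The vectors supported on `S`. -/
def supported {κ : Type*} (F : Type*) [Zero F] (S : Finset κ) : Set (κ → F) :=
  {μ | ∀ j ∉ S, μ j = 0}

theorem prod_le_pow_of_sum_le {b : ℕ} (hb : 0 < b) {z : Fin b → ℝ} (hz : ∀ r, 0 ≤ z r) {a : ℝ}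
    (hs : ∑ r, z r ≤ b * a) : ∏ r, z r ≤ a ^ b := by
  have hb' : (0 : ℝ) < b := by exact_mod_cast hb
  have h := Real.geom_mean_le_arith_mean_weighted Finset.univ (fun _ => (b : ℝ)⁻¹) z
    (fun _ _ => by positivity) (by simp [hb'.ne']) (fun r _ => hz r)
  rw [← Finset.mul_sum] at h
  have h2 : (b : ℝ)⁻¹ * ∑ r, z r ≤ a := by
    rw [inv_mul_le_iff₀ hb']; exact hs
  have h3 := pow_le_pow_left₀ (Finset.prod_nonneg fun r _ => Real.rpow_nonneg (hz r) _)
    (h.trans h2) b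
  rw [← Finset.prod_pow] at h3
  refine le_trans (le_of_eq ?_) h3
  refine Finset.prod_congr rfl fun r _ => ?_
  rw [← Real.rpow_natCast, ← Real.rpow_mul (hz r), inv_mul_cancel₀ hb'.ne', Real.rpow_one]

section RandomSet

variable {κ F Ω : Type*} [Finite κ] [Field F]

theorem ncard_supported (S : Finset κ) : (supported F S).ncard = Nat.card F ^ S.card := by
  classical
  have e : supported F S ≃ (S → F) :=
    { toFun := fun μ j => μ.1 j
      invFun := fun g => ⟨fun j => if hj : j ∈ S then g ⟨j, hj⟩ else 0, fun j hj => by simp [hj]⟩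
      left_inv := fun μ => by
        ext j
        by_cases hj : j ∈ S
        · simp [hj]
        · simp [hj, μ.2 j hj]
      right_inv := fun g => by ext j; simp }
  rw [← Nat.card_coe_set_eq, Nat.card_congr e, Nat.card_fun]
  simp

variable [Finite F] [MeasurableSpace Ω] {ρ : Measure Ω} [IsProbabilityMeasure ρ] {B : Ω → Set (κ → F)}
  {c : ℝ}

theorem prob_exists_mem_supported_le (hc : 0 ≤ c)
    (hp : ∀ μ, μ ≠ 0 → ρ.real {ω | μ ∈ B ω} ≤ c) (S : Finset κ) :
    ρ.real {ω | ∃ μ ∈ B ω, μ ∈ supported F S ∧ μ ≠ 0} ≤ (Nat.card F : ℝ) ^ S.card * c := by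
  classical
  have hfin : (supported F S).Finite := Set.toFinite _
  calc ρ.real {ω | ∃ μ ∈ B ω, μ ∈ supported F S ∧ μ ≠ 0}
      ≤ ρ.real (⋃ μ ∈ hfin.toFinset.erase 0, {ω | μ ∈ B ω}) := by
        refine measureReal_mono (fun ω hω => ?_) (measure_ne_top _ _)
        obtain ⟨μ, h1, h2, h3⟩ := hω
        simp only [Set.mem_iUnion]
        exact ⟨μ, by simp [h2, h3], h1⟩
    _ ≤ ∑ μ ∈ hfin.toFinset.erase 0, ρ.real {ω | μ ∈ B ω} := measureReal_biUnion_finset_le _ _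
    _ ≤ ∑ μ ∈ hfin.toFinset.erase 0, c :=
        Finset.sum_le_sum fun μ hμ => hp μ (Finset.ne_of_mem_erase hμ)
    _ ≤ _ := by
        rw [Finset.sum_const, nsmul_eq_mul]
        refine mul_le_mul_of_nonneg_right ?_ hc
        have h1 := Finset.card_erase_le (s := hfin.toFinset) (a := 0)
        rw [← Set.ncard_eq_toFinset_card _ hfin, ncard_supported] at h1
        exact_mod_cast h1

theorem integral_ncard_le (hc : 0 ≤ c) (hB : ∀ μ, MeasurableSet {ω | μ ∈ B ω})
    (hp : ∀ μ, μ ≠ 0 → ρ.real {ω | μ ∈ B ω} ≤ c) (S : Finset κ) :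
    Integrable (fun ω => (((B ω ∩ supported F S) \ {0}).ncard : ℝ)) ρ ∧
      ∫ ω, (((B ω ∩ supported F S) \ {0}).ncard : ℝ) ∂ρ ≤ (Nat.card F : ℝ) ^ S.card * c := by
  classical
  have hfin : (supported F S).Finite := Set.toFinite _
  have heq : ∀ ω, (((B ω ∩ supported F S) \ {0}).ncard : ℝ) =
      ∑ μ ∈ hfin.toFinset.erase 0, {ω | μ ∈ B ω}.indicator (fun _ => (1 : ℝ)) ω := by
    intro ω
    simp only [Set.indicator_apply, Set.mem_ofPred_eq]
    rw [Finset.sum_boole, ← Set.ncard_coe_finset]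
    congr 2
    ext μ
    simp
    tauto
  have hint : ∀ μ ∈ hfin.toFinset.erase 0,
      Integrable ({ω | μ ∈ B ω}.indicator fun _ => (1 : ℝ)) ρ :=
    fun μ _ => (integrable_const _).indicator (hB μ)
  simp only [heq]
  refine ⟨integrable_finsetSum _ hint, ?_⟩
  rw [integral_finsetSum _ hint]
  calc ∑ μ ∈ hfin.toFinset.erase 0, ∫ ω, {ω | μ ∈ B ω}.indicator (fun _ => (1 : ℝ)) ω ∂ρ
      ≤ ∑ μ ∈ hfin.toFinset.erase 0, c := by
        refine Finset.sum_le_sum fun μ hμ => ?_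
        rw [integral_indicator_const _ (hB μ), smul_eq_mul, mul_one]
        exact hp μ (Finset.ne_of_mem_erase hμ)
    _ ≤ _ := by
        rw [Finset.sum_const, nsmul_eq_mul]
        refine mul_le_mul_of_nonneg_right ?_ hc
        have h1 := Finset.card_erase_le (s := hfin.toFinset) (a := 0)
        rw [← Set.ncard_eq_toFinset_card _ hfin, ncard_supported] at h1
        exact_mod_cast h1

/-- Linearity of expectation bounds the sum over r of the normalised counts of nonzero vectors by b
ε q^{-(R+3)}; one Markov bound for this sum, followed by AM-GM, controls the product with a failure
probability free of b. -/
theorem prob_prod_ncard_gt_le {b : ℕ} (hb : 0 < b) {ε : ℝ} (hε : 0 ≤ ε) {R : ℕ}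
    (hq : 2 ≤ Nat.card F) (hB : ∀ μ, MeasurableSet {ω | μ ∈ B ω})
    (hp : ∀ μ, μ ≠ 0 → ρ.real {ω | μ ∈ B ω} ≤ ε * ((Nat.card F : ℝ) ^ (R + 3))⁻¹)
    (S : Fin b → Finset κ) (hS : ∀ r, R + 1 ≤ (S r).card) :
    ρ.real {ω | ¬ (∏ r, (B ω ∩ supported F (S r)).ncard) * Nat.card F ^ (b * R) ≤
      Nat.card F ^ ∑ r, (S r).card} ≤ ε / 4 := by
  set q : ℝ := (Nat.card F : ℝ) with hqdef
  have hq2 : (2 : ℝ) ≤ q := by rw [hqdef]; exact_mod_cast hq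
  have hq0 : 0 < q := by linarith
  have hb' : (0 : ℝ) < b := by exact_mod_cast hb
  set c := ε * (q ^ (R + 3))⁻¹ with hcdef
  have hc : 0 ≤ c := by positivity
  set f : Ω → ℝ := fun ω => ∑ r, (((B ω ∩ supported F (S r)) \ {0}).ncard : ℝ) *
    (q ^ (S r).card)⁻¹
  have hint : ∀ r ∈ Finset.univ, Integrable (fun ω =>
      (((B ω ∩ supported F (S r)) \ {0}).ncard : ℝ) * (q ^ (S r).card)⁻¹) ρ :=
    fun r _ => ((integral_ncard_le hc hB hp (S r)).1).mul_const _
  have hf0 : ∀ ω, 0 ≤ f ω := fun ω => Finset.sum_nonneg fun r _ => by positivity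
  have hfint : ∫ ω, f ω ∂ρ ≤ b * c := by
    rw [integral_finsetSum _ hint]
    calc _ ≤ ∑ r : Fin b, c := by
          refine Finset.sum_le_sum fun r _ => ?_
          rw [integral_mul_const, mul_inv_le_iff₀ (by positivity), mul_comm]
          exact (integral_ncard_le hc hB hp (S r)).2
      _ = b * c := by simp
  -- The threshold b q^{-(R+1)} lies q² ≥ 4 above the mean bound divided by ε, giving ε/4. The zero
  -- vectors add at most the same amount again, and 2 q^{-(R+1)} ≤ q^{-R}.
  have hmarkov := mul_meas_ge_le_integral_of_nonneg (μ := ρ) (f := f)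
    (Filter.Eventually.of_forall hf0) (integrable_finsetSum _ hint) (b * (q ^ (R + 1))⁻¹)
  have hsub : {ω | ¬ (∏ r, (B ω ∩ supported F (S r)).ncard) * Nat.card F ^ (b * R) ≤
      Nat.card F ^ ∑ r, (S r).card} ⊆ {ω | b * (q ^ (R + 1))⁻¹ ≤ f ω} := by
    intro ω hω
    by_contra hlt
    simp only [Set.mem_ofPred_eq, not_le] at hlt
    refine hω ?_
    set z : Fin b → ℝ := fun r => ((B ω ∩ supported F (S r)).ncard : ℝ) * (q ^ (S r).card)⁻¹
    have hz : ∑ r, z r ≤ b * (q ^ R)⁻¹ := by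
      calc ∑ r, z r ≤ ∑ r, ((((B ω ∩ supported F (S r)) \ {0}).ncard : ℝ) * (q ^ (S r).card)⁻¹ +
            (q ^ (R + 1))⁻¹) := by
            refine Finset.sum_le_sum fun r _ => ?_
            have h1 : ((B ω ∩ supported F (S r)).ncard : ℝ) ≤
                ((B ω ∩ supported F (S r)) \ {0}).ncard + 1 := by
              have := Set.le_ncard_sdiff ({0} : Set (κ → F)) (B ω ∩ supported F (S r))
              rw [Set.ncard_singleton] at this
              exact_mod_cast (by omega : (B ω ∩ supported F (S r)).ncard ≤
                ((B ω ∩ supported F (S r)) \ {0}).ncard + 1)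
            have h2 : (q ^ (S r).card)⁻¹ ≤ (q ^ (R + 1))⁻¹ :=
              inv_anti₀ (by positivity) (pow_le_pow_right₀ (by linarith) (hS r))
            have h3 : 0 < (q ^ (S r).card)⁻¹ := by positivity
            calc z r ≤ (((B ω ∩ supported F (S r)) \ {0}).ncard + 1) * (q ^ (S r).card)⁻¹ :=
                  mul_le_mul_of_nonneg_right h1 h3.le
              _ ≤ _ := by rw [add_mul, one_mul]; gcongr
        _ = f ω + b * (q ^ (R + 1))⁻¹ := by simp [Finset.sum_add_distrib, f]
        _ ≤ b * (2 * (q ^ (R + 1))⁻¹) := by linarith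
        _ ≤ b * (q ^ R)⁻¹ := by
            refine mul_le_mul_of_nonneg_left ?_ hb'.le
            rw [pow_succ, mul_inv]
            have h4 : q⁻¹ ≤ 2⁻¹ := inv_anti₀ (by norm_num) hq2
            have h5 : 0 < (q ^ R)⁻¹ := by positivity
            nlinarith
    have hprod := prod_le_pow_of_sum_le hb (fun r => by positivity) hz
    simp only [z, Finset.prod_mul_distrib, Finset.prod_inv_distrib] at hprod
    rw [Finset.prod_pow_eq_pow_sum, mul_inv_le_iff₀ (by positivity), inv_pow, ← pow_mul,
      inv_mul_eq_div, le_div_iff₀ (by positivity), mul_comm R b] at hprod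
    rw [hqdef] at hprod
    exact_mod_cast hprod
  refine (measureReal_mono hsub (measure_ne_top _ _)).trans ?_
  have hpos : 0 < b * (q ^ (R + 1))⁻¹ := by positivity
  have h6 : b * (q ^ (R + 1))⁻¹ * ρ.real {ω | b * (q ^ (R + 1))⁻¹ ≤ f ω} ≤
      b * (q ^ (R + 1))⁻¹ * (ε / 4) := by
    refine hmarkov.trans (hfint.trans ?_)
    rw [mul_assoc]
    refine mul_le_mul_of_nonneg_left ?_ hb'.le
    have h7 : (q ^ (R + 3))⁻¹ = (q ^ (R + 1))⁻¹ * (q ^ 2)⁻¹ := by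
      rw [← mul_inv, ← pow_add]
    have h8 : (q ^ 2)⁻¹ ≤ 4⁻¹ := inv_anti₀ (by norm_num) (by nlinarith)
    rw [hcdef, h7]
    have h9 : 0 < (q ^ (R + 1))⁻¹ := by positivity
    calc ε * ((q ^ (R + 1))⁻¹ * (q ^ 2)⁻¹) = (q ^ (R + 1))⁻¹ * (ε * (q ^ 2)⁻¹) := by ring
      _ ≤ (q ^ (R + 1))⁻¹ * (ε * 4⁻¹) := by gcongr
      _ = _ := by ring
  exact le_of_mul_le_mul_left h6 hpos

end RandomSet

/-! ### Blocks and rows -/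

section Blocks

variable {ι F : Type*} [Fintype ι] [DecidableEq ι] {h : ι → ℕ} {b : ℕ}

/-- The blocks of the messages in `A`. -/
def blocksOf (h : ι → ℕ) (b : ℕ) (A : Finset ι) : Finset (Block h b) :=
  Finset.univ.filter fun j => j.1 ∈ A

/-- The blocks of the messages in `A` whose entry in position `r` is not a padding zero. -/
def rowBlocks (h : ι → ℕ) (b : ℕ) (A : Finset ι) (r : Fin b) : Finset (Block h b) :=
  Finset.univ.filter fun j => j.1 ∈ A ∧ (j.2 : ℕ) * b + r < h j.1

theorem rowBlocks_subset (A : Finset ι) (r : Fin b) : rowBlocks h b A r ⊆ blocksOf h b A := by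
  intro j hj
  simp only [rowBlocks, blocksOf, Finset.mem_filter, Finset.mem_univ, true_and] at hj ⊢
  exact hj.1

theorem lt_ceil_div_iff {n b j : ℕ} (hb : 0 < b) : j < ⌈(n : ℝ) / b⌉₊ ↔ j * b < n := by
  have hb' : (0 : ℝ) < b := by exact_mod_cast hb
  rw [Nat.lt_ceil, lt_div_iff₀ hb']
  exact_mod_cast Iff.rfl

/-- Only the last block of a message can be padded in position r, so each message loses at most one
block. -/
theorem card_blocksOf_le (hb : 0 < b) (A : Finset ι) (r : Fin b) :
    (blocksOf h b A).card ≤ (rowBlocks h b A r).card + A.card := by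
  rw [← Finset.card_sdiff_add_card_eq_card (rowBlocks_subset A r), add_comm]
  refine Nat.add_le_add_left (Finset.card_le_card_of_injOn (fun j => j.1) ?_ ?_) _
  · intro j hj
    simp only [Finset.coe_sdiff, Set.mem_sdiff, Finset.mem_coe, blocksOf, Finset.mem_filter] at hj
    exact hj.1.2
  · rintro ⟨i, j⟩ hj ⟨i', j'⟩ hj' hii
    obtain rfl : i = i' := hii
    simp only [Finset.coe_sdiff, Set.mem_sdiff, Finset.mem_coe, blocksOf, rowBlocks,
      Finset.mem_filter, Finset.mem_univ, true_and, not_and, not_lt] at hj hj'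
    have h1 := hj.2 hj.1
    have h2 := hj'.2 hj'.1
    have h3 := (lt_ceil_div_iff hb).1 j.2
    have h4 := (lt_ceil_div_iff hb).1 j'.2
    have hr := r.2
    have : (j : ℕ) = j' := by
      have h5 : (j : ℕ) * b < (j' + 1) * b := by rw [add_mul]; omega
      have h6 : (j' : ℕ) * b < (j + 1) * b := by rw [add_mul]; omega
      have h7 := Nat.lt_of_mul_lt_mul_right h5
      have h8 := Nat.lt_of_mul_lt_mul_right h6
      omega
    rw [Fin.ext this]

/-- An unpadded position r of block j of a message is its symbol number j b + r, so distinct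
positions give distinct symbols. -/
theorem sum_card_rowBlocks_le (A : Finset ι) :
    ∑ r, (rowBlocks h b A r).card ≤ ∑ i ∈ A, h i := by
  rw [← Finset.card_sigma]
  have : ∑ i ∈ A, h i = (A.sigma fun i => Finset.range (h i)).card := by simp
  rw [this]
  refine Finset.card_le_card_of_injOn (fun p => ⟨p.2.1, (p.2.2 : ℕ) * b + p.1⟩) ?_ ?_
  · intro p hp
    simp only [Finset.coe_sigma, Set.mem_sigma_iff, Finset.mem_coe, rowBlocks, Finset.mem_filter,
      Finset.mem_univ, true_and] at hp
    simp only [Finset.coe_sigma, Set.mem_sigma_iff, Finset.mem_coe, Finset.mem_range]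
    exact hp
  · rintro ⟨r, i, j⟩ - ⟨r', i', j'⟩ - hp
    simp only [Sigma.mk.injEq] at hp
    obtain ⟨rfl, hp⟩ := hp
    have hp := eq_of_heq hp
    have hb : 0 < b := r.pos
    have h1 : (r : ℕ) = r' := by
      have := congrArg (· % b) hp
      simpa [Nat.mod_eq_of_lt r.2, Nat.mod_eq_of_lt r'.2] using this
    have h2 : (j : ℕ) = j' := by
      rw [h1] at hp
      exact Nat.eq_of_mul_eq_mul_right hb (Nat.add_right_cancel hp)
    rw [Fin.ext h1, Fin.ext h2]

end Blocks

/-- Few solutions: the vectors of `B` that are supported on the blocks of the messages in `A`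
vanish, or there are few ways to choose the columns of a matrix in `B`. -/
def FewSolutions {ι F : Type*} [Fintype ι] [DecidableEq ι] [Field F] {h : ι → ℕ} {b : ℕ}
    (R : ℕ) (B : Set (Block h b → F)) (A : Finset ι) : Prop :=
  (∀ μ ∈ B, μ ∈ supported F (blocksOf h b A) → μ = 0) ∨
    (∏ r, (B ∩ supported F (rowBlocks h b A r)).ncard) * Nat.card F ^ (b * R) ≤
      Nat.card F ^ ∑ i ∈ A, h i

/-- With few blocks a union bound excludes all nonzero vectors; with many blocks the count of
columns concentrates enough. The 3 in the exponent makes the two regimes overlap: one lost block per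
message for up to two messages, and one for the zero vector. -/
theorem prob_not_fewSolutions_le {F Ω : Type*} [Field F] [Finite F] [MeasurableSpace Ω]
    {ρ : Measure Ω} [IsProbabilityMeasure ρ] {h : Fin 2 → ℕ} {b : ℕ} (hb : 0 < b)
    {B : Ω → Set (Block h b → F)} {ε : ℝ} (hε : 0 ≤ ε) {R : ℕ}
    (hB : ∀ μ, MeasurableSet {ω | μ ∈ B ω})
    (hp : ∀ μ, μ ≠ 0 → ρ.real {ω | μ ∈ B ω} ≤ ε * ((Nat.card F : ℝ) ^ (R + 3))⁻¹) :
    ρ.real {ω | ∃ A : Finset (Fin 2), A.Nonempty ∧ ¬ FewSolutions R (B ω) A} ≤ 3 / 4 * ε := by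
  have hq : 2 ≤ Nat.card F := Finite.one_lt_card
  set q : ℝ := (Nat.card F : ℝ) with hqdef
  have hq2 : (2 : ℝ) ≤ q := by rw [hqdef]; exact_mod_cast hq
  have hc : 0 ≤ ε * (q ^ (R + 3))⁻¹ := by positivity
  have hkey : ∀ A : Finset (Fin 2), ∀ d : ℕ, d ≤ 3 → (blocksOf h b A).card + d ≤ R + 3 →
      ρ.real {ω | ∃ μ ∈ B ω, μ ∈ supported F (blocksOf h b A) ∧ μ ≠ 0} ≤ ε * (2⁻¹) ^ d := by
    intro A d hd hA
    refine (prob_exists_mem_supported_le hc hp _).trans ?_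
    rw [mul_left_comm, inv_pow]
    refine mul_le_mul_of_nonneg_left ?_ hε
    rw [← div_eq_mul_inv, div_le_iff₀ (by positivity), inv_mul_eq_div, le_div_iff₀ (by positivity)]
    calc q ^ (blocksOf h b A).card * 2 ^ d ≤ q ^ (blocksOf h b A).card * q ^ d := by gcongr
      _ = q ^ ((blocksOf h b A).card + d) := (pow_add _ _ _).symm
      _ ≤ q ^ (R + 3) := pow_le_pow_right₀ (by linarith) hA
  -- With at most R + 2 blocks altogether, a single event of probability at most ε/2 covers all A;
  -- otherwise each of the three sets A may cost ε/4.
  by_cases hm : (blocksOf h b (Finset.univ : Finset (Fin 2))).card ≤ R + 2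
  · refine le_trans (measureReal_mono ?_ (measure_ne_top _ _))
      ((hkey Finset.univ 1 (by norm_num) (by omega)).trans (by linarith))
    rintro ω ⟨A, -, hA⟩
    simp only [FewSolutions, not_or, not_forall] at hA
    obtain ⟨⟨μ, hμ, -, h0⟩, -⟩ := hA
    exact ⟨μ, hμ, fun j hj => absurd (by simp [blocksOf]) hj, h0⟩
  · have hA : ∀ A : Finset (Fin 2), A.Nonempty →
        ρ.real {ω | ¬ FewSolutions R (B ω) A} ≤ ε / 4 := by
      intro A hA
      by_cases hmA : (blocksOf h b A).card ≤ R + 1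
      · refine le_trans (measureReal_mono ?_ (measure_ne_top _ _))
          ((hkey A 2 (by norm_num) (by omega)).trans (by linarith))
        intro ω hω
        simp only [FewSolutions, not_or, not_forall, Set.mem_ofPred_eq] at hω
        obtain ⟨⟨μ, hμ, h1, h0⟩, -⟩ := hω
        exact ⟨μ, hμ, h1, h0⟩
      · refine le_trans (measureReal_mono ?_ (measure_ne_top _ _))
          (prob_prod_ncard_gt_le hb hε hq hB hp (rowBlocks h b A) fun r => ?_)
        · intro ω hω hle
          exact hω (Or.inr (hle.trans (Nat.pow_le_pow_right (by omega)
            (sum_card_rowBlocks_le A))))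
        -- At least R + 2 blocks remain after losing one if A is a singleton, and at least R + 3
        -- before losing two if A is everything; so each row keeps R + 1.
        · have h1 := card_blocksOf_le (h := h) hb A r
          have h2 : A.card ≤ 2 := by simpa using Finset.card_le_univ A
          rcases h2.lt_or_eq with h3 | h3
          · omega
          · have : A = Finset.univ := by
              rw [← Finset.card_eq_iff_eq_univ, h3, Fintype.card_fin]
            subst this
            omega
    calc ρ.real {ω | ∃ A : Finset (Fin 2), A.Nonempty ∧ ¬ FewSolutions R (B ω) A}
        = ρ.real (⋃ A ∈ (Finset.univ.erase ∅ : Finset (Finset (Fin 2))),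
            {ω | ¬ FewSolutions R (B ω) A}) := by
          congr 1
          ext ω
          simp [Finset.nonempty_iff_ne_empty]
      _ ≤ ∑ A ∈ (Finset.univ.erase ∅ : Finset (Finset (Fin 2))),
            ρ.real {ω | ¬ FewSolutions R (B ω) A} := measureReal_biUnion_finset_le _ _
      _ ≤ ∑ A ∈ (Finset.univ.erase ∅ : Finset (Finset (Fin 2))), ε / 4 :=
          Finset.sum_le_sum fun A hA' => hA A
            (Finset.nonempty_iff_ne_empty.2 (Finset.ne_of_mem_erase hA'))
      _ = 3 / 4 * ε := by
          rw [Finset.sum_const, Finset.card_erase_of_mem (Finset.mem_univ _)]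
          simp
          ring

/-! ### Entropy and typical sequences -/

section Info

variable {A : Type*} [MeasurableSpace A]

/-- The information content of `a`, in nats. -/
def info (Q : Measure A) (a : A) : ℝ := -Real.log (Q.real {a})

theorem info_nonneg (Q : Measure A) [IsProbabilityMeasure Q] (a : A) : 0 ≤ info Q a :=
  neg_nonneg.2 (Real.log_nonpos measureReal_nonneg measureReal_le_one)

theorem mul_info (Q : Measure A) (a : A) :
    Q.real {a} * info Q a = Real.negMulLog (Q.real {a}) := by
  rw [info, Real.negMulLog]; ring

theorem entropy_nonneg (Q : Measure A) [IsProbabilityMeasure Q] : 0 ≤ entropy Q :=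
  div_nonneg (tsum_nonneg fun _ => Real.negMulLog_nonneg measureReal_nonneg measureReal_le_one)
    (Real.log_nonneg (by norm_num))

variable [Countable A] [MeasurableSingletonClass A]

theorem integrable_iff_summable_singleton (Q : Measure A) [IsFiniteMeasure Q] (f : A → ℝ) :
    Integrable f Q ↔ Summable fun a => Q.real {a} * ‖f a‖ := by
  conv_lhs => rw [← Measure.sum_smul_dirac Q]
  exact integrable_sum_dirac_iff fun _ => measure_ne_top _ _

theorem FiniteEntropy.integrable_info {Q : Measure A} [IsProbabilityMeasure Q]
    (hQ : FiniteEntropy Q) : Integrable (info Q) Q := by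
  rw [integrable_iff_summable_singleton]
  refine hQ.congr fun a => ?_
  rw [Real.norm_of_nonneg (info_nonneg Q a), mul_info]

theorem integral_info {Q : Measure A} [IsProbabilityMeasure Q] (hQ : Integrable (info Q) Q) :
    ∫ a, info Q a ∂Q = entropy Q * Real.log 2 := by
  rw [integral_countable hQ, entropy, div_mul_cancel₀ _ (Real.log_pos (by norm_num)).ne']
  simp only [smul_eq_mul, mul_info]

omit [MeasurableSingletonClass A] in
theorem ae_measureReal_singleton_pos (Q : Measure A) [IsFiniteMeasure Q] :
    ∀ᵐ a ∂Q, 0 < Q.real {a} := by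
  have h : Q (⋃ a ∈ {a | Q {a} = 0}, {a}) = 0 :=
    (measure_biUnion_null_iff (Set.to_countable _)).2 fun a ha => ha
  refine measure_mono_null (fun a ha => ?_) h
  have ha' : Q {a} = 0 := by
    by_contra h0
    exact ha (ENNReal.toReal_pos h0 (measure_ne_top _ _))
  simpa using ha'

theorem summable_measureReal_singleton (Q : Measure A) [IsProbabilityMeasure Q] :
    Summable (fun a => Q.real {a}) ∧ ∑' a, Q.real {a} = 1 := by
  have h := integrable_const (μ := Q) (1 : ℝ)
  constructor
  · simpa using (integrable_iff_summable_singleton Q _).1 h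
  · simpa using (integral_countable h).symm

omit [Countable A] [MeasurableSingletonClass A] in
theorem exp_neg_sum_info {l : ℕ} {Q : Measure A} {x : Fin l → A} (hx : ∀ n, 0 < Q.real {x n}) :
    Real.exp (-∑ n, info Q (x n)) = ∏ n, Q.real {x n} := by
  rw [← Finset.sum_neg_distrib, Real.exp_sum]
  refine Finset.prod_congr rfl fun n _ => ?_
  rw [info, neg_neg, Real.exp_log (hx n)]

theorem two_rpow_eq_exp (a : ℝ) : (2 : ℝ) ^ a = Real.exp (a * Real.log 2) := by
  rw [Real.rpow_def_of_pos (by norm_num), mul_comm]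

open Filter Topology in
/-- The weak law of large numbers for finite sequences of independent samples. -/
theorem tendsto_prob_sum_deviation (Q : Measure A) [IsProbabilityMeasure Q] {f : A → ℝ}
    (hf : Integrable f Q) {η : ℝ} (hη : 0 < η) :
    Tendsto (fun l : ℕ => (Measure.pi fun _ : Fin l => Q).real
      {x | η * l < |∑ n, f (x n) - l * ∫ a, f a ∂Q|}) atTop (𝓝 0) := by
  set ρ := Measure.infinitePi fun _ : ℕ => Q
  set X : ℕ → (ℕ → A) → ℝ := fun n ω => f (ω n)
  have hfm : Measurable f := .of_discrete
  have hXm : ∀ n, Measurable (X n) := fun n => hfm.comp (measurable_pi_apply n)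
  have hmap : ∀ n, ρ.map (fun ω => ω n) = Q := fun n =>
    Measure.infinitePi_map_eval (fun _ : ℕ => Q) n
  have hid : ∀ n, IdentDistrib (X n) (X 0) ρ ρ := fun n =>
    ⟨(hXm n).aemeasurable, (hXm 0).aemeasurable, by
      have h : ∀ n, ρ.map (X n) = Q.map f := fun n => by
        rw [← hmap n, Measure.map_map hfm (measurable_pi_apply n)]; rfl
      rw [h, h]⟩
  have hint : Integrable (X 0) ρ := by
    have := hf
    rw [← hmap 0] at this
    exact this.comp_measurable (measurable_pi_apply 0)
  have hmean : ∫ ω, X 0 ω ∂ρ = ∫ a, f a ∂Q := by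
    rw [← hmap 0, integral_map (measurable_pi_apply 0).aemeasurable
      hfm.aestronglyMeasurable]
  have hind : iIndepFun X ρ := iIndepFun_infinitePi fun _ => hfm
  have hlaw := strong_law_ae_real X hint (fun i j hij => hind.indepFun hij) hid
  have hmeas := tendstoInMeasure_of_tendsto_ae (μ := ρ)
    (f := fun n ω => (∑ i ∈ Finset.range n, X i ω) / n) (g := fun _ => ∫ ω, X 0 ω ∂ρ)
    (fun n => ((Finset.measurable_sum _ fun i _ => hXm i).div_const _).aestronglyMeasurable) hlaw
  rw [tendstoInMeasure_iff_measureReal_dist] at hmeas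
  refine squeeze_zero (fun _ => measureReal_nonneg) (fun l => ?_) (hmeas η hη)
  have hpi : (Measure.pi fun _ : Fin l => Q) = ρ.map fun ω (n : Fin l) => ω n := by
    rw [← Measure.infinitePi_eq_pi]
    exact (Measure.map_infinitePi_infinitePi_of_inj (P := fun _ : ℕ => Q)
      (f := fun n : Fin l => (n : ℕ)) Fin.val_injective).symm
  rw [hpi, map_measureReal_apply (by fun_prop) .of_discrete]
  refine measureReal_mono (fun ω hω => ?_) (measure_ne_top _ _)
  simp only [Set.mem_preimage, Set.mem_ofPred_eq] at hω ⊢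
  rw [Real.dist_eq, hmean, Finset.sum_range]
  rcases Nat.eq_zero_or_pos l with rfl | hl
  · simp at hω
  · have hl' : (0 : ℝ) < l := by exact_mod_cast hl
    have : (∑ i : Fin l, X i ω) / l - ∫ a, f a ∂Q =
        (∑ i : Fin l, f (ω i) - l * ∫ a, f a ∂Q) / l := by
      simp only [X]; field_simp
    rw [this, abs_div, abs_of_pos hl', le_div_iff₀ hl']
    exact hω.le

end Info

section Joint

variable {ι : Type*} [Fintype ι] {𝒳 : ι → Type*} [∀ i, Countable (𝒳 i)]
  [∀ i, MeasurableSpace (𝒳 i)] [∀ i, MeasurableSingletonClass (𝒳 i)]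
  {P : Measure (∀ i, 𝒳 i)} [IsProbabilityMeasure P]

instance isProbabilityMeasure_marginal (i : ι) : IsProbabilityMeasure (P.map fun x => x i) :=
  Measure.isProbabilityMeasure_map (measurable_pi_apply i).aemeasurable

omit [Fintype ι] [∀ i, Countable (𝒳 i)] [IsProbabilityMeasure P] in
theorem marginal_singleton (i : ι) (a : 𝒳 i) :
    (P.map fun x => x i).real {a} = P.real {x | x i = a} := by
  rw [map_measureReal_apply (measurable_pi_apply i) (measurableSet_singleton a)]
  rfl

omit [Fintype ι] [∀ i, Countable (𝒳 i)] in
theorem measureReal_singleton_le_marginal (x : ∀ i, 𝒳 i) (i : ι) :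
    P.real {x} ≤ (P.map fun x => x i).real {x i} := by
  rw [marginal_singleton]
  exact measureReal_mono (by simp) (measure_ne_top _ _)

/-- A marginal atom is at least as heavy as the joint atom, so the joint information dominates
almost everywhere. -/
theorem FiniteEntropy.integrable_info_marginal (hP : FiniteEntropy P) (i : ι) :
    Integrable (fun x => info (P.map fun x => x i) (x i)) P ∧
      Integrable (info (P.map fun x => x i)) (P.map fun x => x i) := by
  have h1 : Integrable (fun x => info (P.map fun x => x i) (x i)) P := by
    refine hP.integrable_info.mono' (Measurable.of_discrete).aestronglyMeasurable ?_
    filter_upwards [ae_measureReal_singleton_pos P] with x hx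
    rw [Real.norm_of_nonneg (info_nonneg _ _), info, info]
    exact neg_le_neg (Real.log_le_log hx (measureReal_singleton_le_marginal x i))
  refine ⟨h1, ?_⟩
  rw [integrable_map_measure (Measurable.of_discrete).aestronglyMeasurable
    (measurable_pi_apply i).aemeasurable]
  exact h1

theorem FiniteEntropy.integral_info_marginal (hP : FiniteEntropy P) (i : ι) :
    ∫ x, info (P.map fun x => x i) (x i) ∂P =
      entropy (P.map fun x => x i) * Real.log 2 := by
  rw [← integral_info (hP.integrable_info_marginal i).2,
    integral_map (measurable_pi_apply i).aemeasurable (Measurable.of_discrete).aestronglyMeasurable]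

/-- Gibbs' inequality against the product of the marginals, from log t ≤ t - 1 with t the ratio of
the two atoms. -/
theorem FiniteEntropy.entropy_le_sum (hP : FiniteEntropy P) :
    entropy P ≤ ∑ i, entropy (P.map fun x => x i) := by
  set R : Measure (∀ i, 𝒳 i) := Measure.pi fun i => P.map fun x => x i
  have hlog : 0 < Real.log 2 := Real.log_pos (by norm_num)
  have hs := summable_measureReal_singleton P
  have hR := summable_measureReal_singleton R
  set g : (∀ i, 𝒳 i) → ℝ := fun x => ∑ i, info (P.map fun x => x i) (x i)
  have hg : Integrable g P :=
    integrable_finsetSum _ fun i _ => (hP.integrable_info_marginal i).1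
  have hgs : Summable fun x => P.real {x} * g x := by
    refine ((integrable_iff_summable_singleton P g).1 hg).congr fun x => ?_
    rw [Real.norm_of_nonneg (Finset.sum_nonneg fun i _ => info_nonneg _ _)]
  have hgi : ∑' x, P.real {x} * g x =
      (∑ i, entropy (P.map fun x => x i)) * Real.log 2 := by
    rw [Finset.sum_mul]
    simp only [← hP.integral_info_marginal]
    rw [← integral_finsetSum _ fun i _ => (hP.integrable_info_marginal i).1,
      integral_countable hg]
    rfl
  have hRx : ∀ x, R.real {x} = ∏ i, (P.map fun x => x i).real {x i} := by
    intro x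
    rw [measureReal_def, Measure.pi_singleton, ENNReal.toReal_prod]
    rfl
  have hterm : ∀ x, Real.negMulLog (P.real {x}) ≤ P.real {x} * g x + (R.real {x} - P.real {x}) := by
    intro x
    rcases (measureReal_nonneg (μ := P) (s := {x})).eq_or_lt with h0 | hpos
    · rw [← h0]
      simp [measureReal_nonneg]
    · have hi : ∀ i ∈ Finset.univ, (P.map fun x => x i).real {x i} ≠ 0 := fun i _ =>
        (hpos.trans_le (measureReal_singleton_le_marginal x i)).ne'
      have hRpos : 0 < R.real {x} := by
        rw [hRx]
        exact Finset.prod_pos fun i hi' => lt_of_le_of_ne measureReal_nonneg (hi i hi').symm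
      have hgx : g x = -Real.log (R.real {x}) := by
        rw [hRx, Real.log_prod hi, ← Finset.sum_neg_distrib]
        rfl
      have h1 := Real.log_le_sub_one_of_pos (div_pos hRpos hpos)
      rw [Real.log_div hRpos.ne' hpos.ne'] at h1
      have h2 := mul_le_mul_of_nonneg_left h1 hpos.le
      rw [mul_sub, mul_sub, mul_div_cancel₀ _ hpos.ne'] at h2
      rw [hgx, Real.negMulLog]
      linarith
  have hle := hP.tsum_le_tsum hterm (hgs.add (hR.1.sub hs.1))
  rw [hgs.tsum_add (hR.1.sub hs.1), hR.1.tsum_sub hs.1, hs.2, hR.2, hgi] at hle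
  rw [entropy, div_le_iff₀ hlog]
  linarith

/-- The sequences that are weakly typical (with one-sided conditions). -/
def typicalSet (P : Measure (∀ i, 𝒳 i)) (η : ℝ) (l : ℕ) : Set (Fin l → ∀ i, 𝒳 i) :=
  {x | (2 : ℝ) ^ (-(l * (entropy P + η))) ≤ ∏ n, P.real {x n} ∧
    ∀ i, ∏ n, (P.map fun x => x i).real {x n i} ≤
      (2 : ℝ) ^ (-(l * (entropy (P.map fun x => x i) - η)))}

open Filter Topology in
theorem tendsto_prob_typicalSet_compl (hP : FiniteEntropy P) {η : ℝ} (hη : 0 < η) :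
    Tendsto (fun l : ℕ => (Measure.pi fun _ : Fin l => P).real (typicalSet P η l)ᶜ)
      atTop (𝓝 0) := by
  have hlog : 0 < Real.log 2 := Real.log_pos (by norm_num)
  have hη' : 0 < η * Real.log 2 := mul_pos hη hlog
  have h1 := tendsto_prob_sum_deviation P hP.integrable_info hη'
  have h2 := fun i => tendsto_prob_sum_deviation P (hP.integrable_info_marginal i).1 hη'
  have hsum := h1.add (tendsto_finsetSum Finset.univ fun i _ => h2 i)
  simp only [Finset.sum_const_zero, add_zero] at hsum
  refine squeeze_zero (fun _ => measureReal_nonneg) (fun l => ?_) hsum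
  have hae : ∀ᵐ x ∂(Measure.pi fun _ : Fin l => P), ∀ n, 0 < P.real {x n} :=
    ae_all_iff.2 fun n =>
      (measurePreserving_eval (fun _ : Fin l => P) n).quasiMeasurePreserving.ae
        (ae_measureReal_singleton_pos P)
  set D1 : Set (Fin l → ∀ i, 𝒳 i) :=
    {x | η * Real.log 2 * l < |∑ n, info P (x n) - l * ∫ a, info P a ∂P|}
  set D2 : ι → Set (Fin l → ∀ i, 𝒳 i) := fun i =>
    {x | η * Real.log 2 * l < |∑ n, info (P.map fun x => x i) (x n i) -
      l * ∫ a, info (P.map fun x => x i) (a i) ∂P|}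
  calc (Measure.pi fun _ : Fin l => P).real (typicalSet P η l)ᶜ
      ≤ (Measure.pi fun _ : Fin l => P).real (D1 ∪ ⋃ i ∈ Finset.univ, D2 i) := by
        refine ENNReal.toReal_mono (measure_ne_top _ _) (measure_mono_ae ?_)
        filter_upwards [hae] with x hx hxT
        by_contra hnot
        refine hxT ?_
        have hnot' : x ∉ D1 ∧ ∀ i, x ∉ D2 i := by
          constructor
          · exact fun h => hnot (Or.inl h)
          · exact fun i h => hnot (Or.inr (by simpa using ⟨i, h⟩))
        obtain ⟨hn1, hn2⟩ := hnot'
        simp only [D1, D2, Set.mem_ofPred_eq, not_lt, abs_le] at hn1 hn2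
        rw [integral_info hP.integrable_info] at hn1
        refine ⟨?_, fun i => ?_⟩
        · rw [← exp_neg_sum_info hx, two_rpow_eq_exp]
          refine Real.exp_le_exp.2 ?_
          linarith [hn1.2]
        · have hi := hn2 i
          rw [hP.integral_info_marginal] at hi
          rw [← exp_neg_sum_info fun n => (hx n).trans_le (measureReal_singleton_le_marginal _ i),
            two_rpow_eq_exp]
          refine Real.exp_le_exp.2 ?_
          linarith [hi.1]
    _ ≤ (Measure.pi fun _ : Fin l => P).real D1 +
          (Measure.pi fun _ : Fin l => P).real (⋃ i ∈ Finset.univ, D2 i) := measureReal_union_le _ _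
    _ ≤ _ := by
        gcongr
        exact measureReal_biUnion_finset_le _ _

omit [∀ i, Countable (𝒳 i)] in
theorem card_mul_le_of_subset_typicalSet {η : ℝ} {l : ℕ} {S : Finset (Fin l → ∀ i, 𝒳 i)}
    (hS : (S : Set (Fin l → ∀ i, 𝒳 i)) ⊆ typicalSet P η l) :
    S.card ≤ (Measure.pi fun _ : Fin l => P).real S * (2 : ℝ) ^ (l * (entropy P + η)) := by
  have h1 : S.card * (2 : ℝ) ^ (-(l * (entropy P + η))) ≤
      (Measure.pi fun _ : Fin l => P).real S := by
    rw [← sum_measureReal_singleton, ← nsmul_eq_mul]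
    refine Finset.card_nsmul_le_sum _ _ _ fun x hx => ?_
    rw [measureReal_def, Measure.pi_singleton, ENNReal.toReal_prod]
    exact (hS hx).1
  rw [Real.rpow_neg (by norm_num), ← div_eq_mul_inv, div_le_iff₀ (by positivity)] at h1
  exact h1

omit [∀ i, Countable (𝒳 i)] in
theorem finite_typicalSet (η : ℝ) (l : ℕ) : (typicalSet P η l).Finite := by
  by_contra hinf
  -- One point more than the cardinality bound permits.
  obtain ⟨S, hS, hcard⟩ := Set.Infinite.exists_subset_card_eq hinf
    (⌊(2 : ℝ) ^ (l * (entropy P + η))⌋₊ + 1)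
  have h1 := card_mul_le_of_subset_typicalSet hS
  have h2 : (Measure.pi fun _ : Fin l => P).real S * (2 : ℝ) ^ (l * (entropy P + η)) ≤
      1 * (2 : ℝ) ^ (l * (entropy P + η)) :=
    mul_le_mul_of_nonneg_right measureReal_le_one (by positivity)
  have h3 := Nat.lt_floor_add_one ((2 : ℝ) ^ (l * (entropy P + η)))
  rw [hcard] at h1
  push_cast at h1
  linarith

omit [∀ i, Countable (𝒳 i)] in
-- The sequences with the given coordinate i have total mass at most 2^{-l(H_i - η)}, and each
-- typical one weighs at least 2^{-l(H + η)}. No conditional entropy is needed.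
theorem card_agree_le {η : ℝ} {l : ℕ} {S : Finset (Fin l → ∀ i, 𝒳 i)}
    (hS : (S : Set (Fin l → ∀ i, 𝒳 i)) ⊆ typicalSet P η l) {x : Fin l → ∀ i, 𝒳 i}
    (hx : x ∈ typicalSet P η l) (i : ι) (hi : ∀ x' ∈ S, ∀ n, x' n i = x n i) :
    S.card ≤ (2 : ℝ) ^ (l * (entropy P - entropy (P.map fun x => x i) + 2 * η)) := by
  refine (card_mul_le_of_subset_typicalSet hS).trans ?_
  have h1 : (Measure.pi fun _ : Fin l => P).real S ≤
      (2 : ℝ) ^ (-(l * (entropy (P.map fun x => x i) - η))) := by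
    refine le_trans ?_ (hx.2 i)
    calc (Measure.pi fun _ : Fin l => P).real S
        ≤ (Measure.pi fun _ : Fin l => P).real (Set.univ.pi fun n => {y | y i = x n i}) :=
          measureReal_mono (fun x' hx' n _ => hi x' hx' n) (measure_ne_top _ _)
      _ = ∏ n, (P.map fun x => x i).real {x n i} := by
          rw [measureReal_def, Measure.pi_pi, ENNReal.toReal_prod]
          exact Finset.prod_congr rfl fun n _ => (marginal_singleton i _).symm
  refine (mul_le_mul_of_nonneg_right h1 (by positivity)).trans (le_of_eq ?_)
  rw [← Real.rpow_add (by norm_num)]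
  congr 1
  ring

end Joint

theorem card_differ_le {𝒳 : Fin 2 → Type*} [∀ i, Countable (𝒳 i)]
    [∀ i, MeasurableSpace (𝒳 i)] [∀ i, MeasurableSingletonClass (𝒳 i)]
    {P : Measure (∀ i, 𝒳 i)} [IsProbabilityMeasure P] {η : ℝ} (hη : 0 ≤ η) {l : ℕ}
    {S : Finset (Fin l → ∀ i, 𝒳 i)}
    (hS : (S : Set (Fin l → ∀ i, 𝒳 i)) ⊆ typicalSet P η l) {x : Fin l → ∀ i, 𝒳 i}
    (hx : x ∈ typicalSet P η l) {A : Finset (Fin 2)} (hA : A.Nonempty)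
    (hSA : ∀ x' ∈ S, ∀ i ∉ A, ∀ n, x' n i = x n i) :
    S.card ≤ (2 : ℝ) ^ (l * (entropy P - ∑ i ∈ Aᶜ, entropy (P.map fun x => x i) + 2 * η)) := by
  have hc : Aᶜ.card ≤ 1 := by
    have := hA.card_pos
    rw [Finset.card_compl, Fintype.card_fin]
    omega
  rcases Finset.card_le_one_iff_subset_singleton.1 hc with ⟨i, hi⟩
  rcases Finset.subset_singleton_iff.1 hi with h0 | h1
  · rw [h0, Finset.sum_empty, sub_zero]
    refine (card_mul_le_of_subset_typicalSet hS).trans ?_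
    calc _ ≤ 1 * (2 : ℝ) ^ (l * (entropy P + η)) :=
          mul_le_mul_of_nonneg_right measureReal_le_one (by positivity)
      _ ≤ _ := by
          rw [one_mul]
          refine Real.rpow_le_rpow_of_exponent_le (by norm_num) ?_
          gcongr
          linarith
  · rw [h1, Finset.sum_singleton]
    refine card_agree_le hS hx i fun x' hx' n => hSA x' hx' i ?_ n
    rw [← Finset.mem_compl, h1]
    exact Finset.mem_singleton_self i

/-! ### Random binning -/

section Binning

variable {ι : Type*} [Fintype ι] {𝒳 : ι → Type*} {l : ℕ} {K : ι → ℕ} [∀ i, NeZero (K i)]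

instance isProbabilityMeasure_codebookLaw : IsProbabilityMeasure (codebookLaw 𝒳 l K) := by
  unfold codebookLaw; infer_instance

theorem uniformOn_fin_singleton {n : ℕ} (k : Fin n) :
    uniformOn (Set.univ : Set (Fin n)) {k} = (n : ENNReal)⁻¹ := by
  rw [uniformOn_univ, Measure.count_singleton, Fintype.card_fin, one_div]

theorem infinitePi_uniform_pair_le {X : Type*} {n : ℕ} [NeZero n] (x x' : X) (k k' : Fin n)
    [Decidable (x = x')] :
    (Measure.infinitePi fun _ : X => uniformOn (Set.univ : Set (Fin n)))
      {f | f x = k ∧ f x' = k'} ≤ (n : ENNReal)⁻¹ * if x = x' then 1 else (n : ENNReal)⁻¹ := by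
  classical
  have h : ∀ s : Finset X, ∀ t : X → Set (Fin n),
      (Measure.infinitePi fun _ : X => uniformOn (Set.univ : Set (Fin n))) (Set.pi s t) =
        ∏ i ∈ s, uniformOn (Set.univ : Set (Fin n)) (t i) := fun s t =>
    Measure.infinitePi_pi _ fun _ _ => .of_discrete
  split_ifs with hx
  · have := h {x} fun _ => {k}
    rw [Finset.prod_singleton, uniformOn_fin_singleton] at this
    rw [mul_one, ← this]
    exact measure_mono fun f hf => by simpa using hf.1
  · have := h {x, x'} fun y => if y = x then {k} else {k'}
    rw [Finset.prod_pair hx, if_pos rfl, if_neg (Ne.symm hx), uniformOn_fin_singleton,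
      uniformOn_fin_singleton] at this
    rw [← this]
    refine measure_mono fun f hf => ?_
    intro y hy
    simp only [Finset.coe_insert, Finset.coe_singleton, Set.mem_insert_iff,
      Set.mem_singleton_iff] at hy
    rcases hy with rfl | rfl
    · simpa using hf.1
    · simpa [Ne.symm hx] using hf.2

/-- Messages in A get two independent uniform bins, the others a common one. Summing over the bins k
of ξ cancels one full factor ∏ 1/K_i and leaves at most n choices of k', each weighted by ∏_A 1/K_i.
-/
theorem codebookLaw_real_le {ξ ξ' : ∀ i, Fin l → 𝒳 i} {A : Finset ι}
    (hA : ∀ i, i ∈ A ↔ ξ i ≠ ξ' i) (Q : (∀ i, Fin (K i)) → (∀ i, Fin (K i)) → Prop) {n : ℕ}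
    (hQ : ∀ k, {k' | (∀ i ∉ A, k' i = k i) ∧ Q k k'}.ncard ≤ n) :
    (codebookLaw 𝒳 l K).real {cb | Q (fun i => cb i (ξ i)) (fun i => cb i (ξ' i))} ≤
      n * ∏ i ∈ A, (K i : ℝ)⁻¹ := by
  classical
  set G : (∀ i, Fin (K i)) → Finset (∀ i, Fin (K i)) := fun k =>
    Finset.univ.filter fun k' => (∀ i ∉ A, k' i = k i) ∧ Q k k' with hG
  have hGc : ∀ k, (G k).card ≤ n := by
    intro k
    rw [← Set.ncard_coe_finset]
    simpa [hG] using hQ k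
  have hpair : ∀ k k', (codebookLaw 𝒳 l K)
      {cb | (fun i => cb i (ξ i)) = k ∧ (fun i => cb i (ξ' i)) = k'} ≤
        (∏ i, (K i : ENNReal)⁻¹) * ∏ i ∈ A, (K i : ENNReal)⁻¹ := by
    intro k k'
    have : {cb : Codebook 𝒳 l K | (fun i => cb i (ξ i)) = k ∧ (fun i => cb i (ξ' i)) = k'} =
        Set.univ.pi fun i => {f | f (ξ i) = k i ∧ f (ξ' i) = k' i} := by
      ext cb
      simp [funext_iff, forall_and]
    have hite : ∏ i ∈ A, (K i : ENNReal)⁻¹ = ∏ i, if i ∈ A then (K i : ENNReal)⁻¹ else 1 := by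
      rw [Finset.prod_ite_mem, Finset.univ_inter]
    rw [this, codebookLaw, Measure.pi_pi, hite, ← Finset.prod_mul_distrib]
    refine Finset.prod_le_prod' fun i _ => ?_
    refine (infinitePi_uniform_pair_le _ _ _ _).trans (le_of_eq ?_)
    by_cases hi : ξ i = ξ' i
    · simp [hi, hA]
    · simp [hi, hA]
  have hpair' : ∀ k k', (codebookLaw 𝒳 l K).real
      {cb | (fun i => cb i (ξ i)) = k ∧ (fun i => cb i (ξ' i)) = k'} ≤
        (∏ i, (K i : ℝ)⁻¹) * ∏ i ∈ A, (K i : ℝ)⁻¹ := by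
    intro k k'
    have h1 : ∀ i, (K i : ENNReal)⁻¹ ≠ ⊤ := fun i => by simp [NeZero.ne]
    refine (ENNReal.toReal_mono (ENNReal.mul_ne_top (ENNReal.prod_ne_top fun i _ => h1 i)
      (ENNReal.prod_ne_top fun i _ => h1 i)) (hpair k k')).trans (le_of_eq ?_)
    simp [ENNReal.toReal_prod]
  calc (codebookLaw 𝒳 l K).real {cb | Q (fun i => cb i (ξ i)) (fun i => cb i (ξ' i))}
      ≤ (codebookLaw 𝒳 l K).real (⋃ p ∈ Finset.univ.sigma G,
          {cb | (fun i => cb i (ξ i)) = p.1 ∧ (fun i => cb i (ξ' i)) = p.2}) := by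
        refine measureReal_mono (fun cb hcb => ?_) (measure_ne_top _ _)
        simp only [Set.mem_iUnion]
        refine ⟨⟨fun i => cb i (ξ i), fun i => cb i (ξ' i)⟩, ?_, rfl, rfl⟩
        simp only [Finset.mem_sigma, Finset.mem_univ, true_and, hG, Finset.mem_filter]
        refine ⟨fun i hi => ?_, hcb⟩
        rw [not_not.1 (mt (hA i).2 hi)]
    _ ≤ ∑ p ∈ Finset.univ.sigma G, (∏ i, (K i : ℝ)⁻¹) * ∏ i ∈ A, (K i : ℝ)⁻¹ :=
        (measureReal_biUnion_finset_le _ _).trans (Finset.sum_le_sum fun p _ => hpair' _ _)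
    _ = ∑ k, ((G k).card : ℝ) * ((∏ i, (K i : ℝ)⁻¹) * ∏ i ∈ A, (K i : ℝ)⁻¹) := by
        rw [Finset.sum_const, Finset.card_sigma, nsmul_eq_mul, Nat.cast_sum, Finset.sum_mul]
    _ ≤ ∑ _k : (∀ i, Fin (K i)), (n : ℝ) * ((∏ i, (K i : ℝ)⁻¹) * ∏ i ∈ A, (K i : ℝ)⁻¹) := by
        refine Finset.sum_le_sum fun k _ => ?_
        refine mul_le_mul_of_nonneg_right (by exact_mod_cast hGc k) ?_
        exact mul_nonneg (Finset.prod_nonneg fun i _ => by positivity)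
          (Finset.prod_nonneg fun i _ => by positivity)
    _ = n * ∏ i ∈ A, (K i : ℝ)⁻¹ := by
        rw [Finset.sum_const, Finset.card_univ, Fintype.card_pi, nsmul_eq_mul]
        simp only [Fintype.card_fin, Nat.cast_prod]
        have : (∏ i, (K i : ℝ)) * ∏ i, (K i : ℝ)⁻¹ = 1 := by
          rw [← Finset.prod_mul_distrib]
          exact Finset.prod_eq_one fun i _ => mul_inv_cancel₀ (by simp [NeZero.ne])
        linear_combination (n * ∏ i ∈ A, (K i : ℝ)⁻¹) * this

end Binning

/-! ### Confusable bin indices -/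

section Columns

variable {ι F : Type*} [Fintype ι] [DecidableEq ι] [Field F] {h : ι → ℕ} {b : ℕ}

/-- The vector of the entries in position `r` of the blocks. -/
def column (y : ∀ i, Fin (h i) → F) (r : Fin b) : Block h b → F := fun j => blockContent y j r

/-- All columns of the difference between the blocks of `y'` and of `y` lie in `B`. -/
def Confusable (B : Set (Block h b → F)) (y y' : ∀ i, Fin (h i) → F) : Prop :=
  ∀ r, column y' r - column y r ∈ B

theorem column_sub_mem_supported {y y' : ∀ i, Fin (h i) → F} {A : Finset ι}
    (hy : ∀ i ∉ A, y' i = y i) (r : Fin b) :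
    column y' r - column y r ∈ supported F (rowBlocks h b A r) := by
  intro j hj
  simp only [rowBlocks, Finset.mem_filter, Finset.mem_univ, true_and, not_and, not_lt] at hj
  simp only [Pi.sub_apply, column, blockContent]
  by_cases hjA : j.1 ∈ A
  · simp [not_lt.2 (hj hjA)]
  · simp [hy j.1 hjA]

omit [Fintype ι] [DecidableEq ι] in
theorem eq_of_column_eq (hb : 0 < b) {y y' : ∀ i, Fin (h i) → F}
    (hyy : ∀ r : Fin b, column y r = column y' r) : y = y' := by
  funext i n
  have hj : (n : ℕ) / b < ⌈(h i : ℝ) / b⌉₊ :=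
    (lt_ceil_div_iff hb).2 ((Nat.div_mul_le_self _ _).trans_lt n.2)
  have h1 := congrFun (hyy ⟨n % b, Nat.mod_lt _ hb⟩) ⟨i, ⟨n / b, hj⟩⟩
  have h2 : (n : ℕ) / b * b + n % b = n := Nat.div_add_mod' _ _
  simpa [column, blockContent, h2] using h1

omit [DecidableEq ι] in
theorem encode_eq_iff {y y' : ∀ i, Fin (h i) → F} {a : Block h b → F} :
    encode y' a = encode y a ↔ ∀ r, a ⬝ᵥ (column y' r - column y r) = 0 := by
  rw [encode, encode, Prod.mk.injEq, and_iff_right rfl, funext_iff]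
  refine forall_congr' fun r => ?_
  rw [dotProduct_sub, sub_eq_zero]
  simp [dotProduct, column]

variable [Finite F] {K : ι → ℕ}

/-- B is a union of subspaces with no linear structure, so solutions are merely counted column by
column; the columns determine the labels and hence the bins. -/
theorem ncard_confusable_le_prod (hb : 0 < b) (lab : ∀ i, Fin (K i) ↪ (Fin (h i) → F))
    (B : Set (Block h b → F)) (A : Finset ι) (k : ∀ i, Fin (K i)) :
    {k' : ∀ i, Fin (K i) | (∀ i ∉ A, k' i = k i) ∧
      Confusable B (fun i => lab i (k i)) (fun i => lab i (k' i))}.ncard ≤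
      ∏ r, (B ∩ supported F (rowBlocks h b A r)).ncard := by
  classical
  have hfin : ∀ r, (B ∩ supported F (rowBlocks h b A r)).Finite := fun r => Set.toFinite _
  have hprod : ∏ r, (B ∩ supported F (rowBlocks h b A r)).ncard =
      (Fintype.piFinset fun r => (hfin r).toFinset).card := by
    rw [Fintype.card_piFinset]
    exact Finset.prod_congr rfl fun r _ => Set.ncard_eq_toFinset_card _ _
  rw [hprod, ← Set.ncard_coe_finset]
  refine Set.ncard_le_ncard_of_injOn (fun k' => fun r =>
    column (fun i => lab i (k' i)) r - column (fun i => lab i (k i)) r) ?_ ?_ (Set.toFinite _)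
  · rintro k' ⟨h1, h2⟩
    simp only [Finset.mem_coe, Fintype.mem_piFinset, Set.Finite.mem_toFinset]
    exact fun r => ⟨h2 r, column_sub_mem_supported (fun i hi => by rw [h1 i hi]) r⟩
  · intro k₁ _ k₂ _ h12
    have h3 : (fun i => lab i (k₁ i)) = fun i => lab i (k₂ i) :=
      eq_of_column_eq hb fun r => sub_left_injective (congrFun h12 r)
    funext i
    exact (lab i).injective (congrFun h3 i)

omit [Finite F] in
theorem ncard_confusable_le_one (hb : 0 < b) (lab : ∀ i, Fin (K i) ↪ (Fin (h i) → F))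
    {B : Set (Block h b → F)} {A : Finset ι}
    (hB : ∀ μ ∈ B, μ ∈ supported F (blocksOf h b A) → μ = 0) (k : ∀ i, Fin (K i)) :
    {k' : ∀ i, Fin (K i) | (∀ i ∉ A, k' i = k i) ∧
      Confusable B (fun i => lab i (k i)) (fun i => lab i (k' i))}.ncard ≤ 1 := by
  refine (Set.ncard_le_ncard (t := {k}) ?_ (Set.finite_singleton k)).trans
    (Set.ncard_singleton k).le
  rintro k' ⟨h1, h2⟩
  have h3 : (fun i => lab i (k' i)) = fun i => lab i (k i) := by
    refine eq_of_column_eq hb fun r => sub_eq_zero.1 (hB _ (h2 r) fun j hj => ?_)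
    exact column_sub_mem_supported (fun i hi => by rw [h1 i hi]) r j
      fun hj' => hj (rowBlocks_subset A r hj')
  funext i
  exact (lab i).injective (congrFun h3 i)

theorem codebookLaw_confusable_le {𝒳 : ι → Type*} {l : ℕ} [∀ i, NeZero (K i)] (hb : 0 < b)
    (lab : ∀ i, Fin (K i) ↪ (Fin (h i) → F)) {B : Set (Block h b → F)} {A : Finset ι} {R : ℕ}
    (hB : FewSolutions R B A) {ξ ξ' : ∀ i, Fin l → 𝒳 i} (hA : ∀ i, i ∈ A ↔ ξ i ≠ ξ' i) :
    (codebookLaw 𝒳 l K).real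
      {cb | Confusable B (fun i => lab i (cb i (ξ i))) (fun i => lab i (cb i (ξ' i)))} ≤
      max 1 ((Nat.card F : ℝ) ^ (∑ i ∈ A, h i) / (Nat.card F : ℝ) ^ (b * R)) *
        ∏ i ∈ A, (K i : ℝ)⁻¹ := by
  have hK : 0 ≤ ∏ i ∈ A, (K i : ℝ)⁻¹ := Finset.prod_nonneg fun i _ => by positivity
  have hq : (0 : ℝ) < Nat.card F := by exact_mod_cast Nat.card_pos
  rcases hB with hB | hB
  · refine (codebookLaw_real_le hA (fun k k' => Confusable B (fun i => lab i (k i))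
      (fun i => lab i (k' i))) (ncard_confusable_le_one hb lab hB)).trans ?_
    refine mul_le_mul_of_nonneg_right ?_ hK
    simp
  · refine (codebookLaw_real_le hA (fun k k' => Confusable B (fun i => lab i (k i))
      (fun i => lab i (k' i))) (ncard_confusable_le_prod hb lab B A)).trans ?_
    refine mul_le_mul_of_nonneg_right (le_max_of_le_right ?_) hK
    rw [le_div_iff₀ (by positivity)]
    exact_mod_cast hB

end Columns

/-! ### The union bound over confusable typical sequences -/

theorem numBins_pos (l : ℕ) (H δ : ℝ) : 0 < numBins l H δ := Nat.ceil_pos.2 (by positivity)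

instance neZero_numBins (l : ℕ) (H δ : ℝ) : NeZero (numBins l H δ) := ⟨(numBins_pos l H δ).ne'⟩

theorem rpow_le_numBins (l : ℕ) (H δ : ℝ) : (2 : ℝ) ^ (l * (H + δ)) ≤ numBins l H δ :=
  Nat.le_ceil _

theorem rpow_div_logb {q : ℕ} (hq : 2 ≤ q) (a : ℝ) :
    (q : ℝ) ^ (a / Real.logb 2 q) = (2 : ℝ) ^ a := by
  have hq' : (2 : ℝ) ≤ q := by exact_mod_cast hq
  have hlog : 0 < Real.logb 2 q := Real.logb_pos (by norm_num) (by linarith)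
  have h2 : (2 : ℝ) ^ Real.logb 2 q = q :=
    Real.rpow_logb (by norm_num) (by norm_num) (by linarith)
  calc (q : ℝ) ^ (a / Real.logb 2 q) = ((2 : ℝ) ^ Real.logb 2 q) ^ (a / Real.logb 2 q) := by rw [h2]
    _ = (2 : ℝ) ^ a := by rw [← Real.rpow_mul (by norm_num), mul_div_cancel₀ _ hlog.ne']

/-- Rounding the label length up costs at most one symbol, hence the factor q. -/
theorem pow_indexLength_le {q : ℕ} (hq : 2 ≤ q) (l : ℕ) {H δ : ℝ} (hH : 0 ≤ H + δ) :
    (q : ℝ) ^ indexLength q l H δ ≤ q * numBins l H δ := by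
  have hq' : (2 : ℝ) ≤ q := by exact_mod_cast hq
  have hlog : 0 < Real.logb 2 q := Real.logb_pos (by norm_num) (by linarith)
  have h1 : (indexLength q l H δ : ℝ) ≤ 1 + l * (H + δ) / Real.logb 2 q := by
    have := (Nat.ceil_lt_add_one (show 0 ≤ (l : ℝ) / Real.logb 2 q * (H + δ) by positivity)).le
    rw [indexLength]
    refine this.trans (le_of_eq ?_)
    ring
  rw [← Real.rpow_natCast]
  calc (q : ℝ) ^ (indexLength q l H δ : ℝ) ≤ (q : ℝ) ^ (1 + l * (H + δ) / Real.logb 2 q) :=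
        Real.rpow_le_rpow_of_exponent_le (by linarith) h1
    _ = q * (2 : ℝ) ^ (l * (H + δ)) := by
        rw [Real.rpow_add (by linarith), Real.rpow_one, rpow_div_logb hq]
    _ ≤ _ := by gcongr; exact rpow_le_numBins l H δ

/-- The first entry of the maximum is the chance that x' falls into the very same bins;
subadditivity of entropy controls it. The second uses that bR symbols carry at least l(H' + 2δ)
bits, with q² paying for the rounding of two label lengths. -/
theorem confusion_bound {q : ℕ} (hq : 2 ≤ q) {l b R : ℕ} (hb : 0 < b) {H : Fin 2 → ℝ} {H' δ : ℝ}
    (hH : ∀ i, 0 ≤ H i) (hle : H' ≤ ∑ i, H i) (hδ : 0 < δ)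
    (hR : (l : ℝ) / (b * Real.logb 2 q) * (H' + 2 * δ) ≤ R) {A : Finset (Fin 2)}
    (hA : A.Nonempty) :
    max 1 ((q : ℝ) ^ (∑ i ∈ A, indexLength q l (H i) δ) / (q : ℝ) ^ (b * R)) *
      ∏ i ∈ A, (numBins l (H i) δ : ℝ)⁻¹ ≤
      (q : ℝ) ^ 2 * (2 : ℝ) ^ (-(l * (H' - ∑ i ∈ Aᶜ, H i + δ))) := by
  have hq' : (2 : ℝ) ≤ q := by exact_mod_cast hq
  have hq0 : (0 : ℝ) < q := by linarith
  have hlog : 0 < Real.logb 2 q := Real.logb_pos (by norm_num) (by linarith)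
  have hb' : (0 : ℝ) < b := by exact_mod_cast hb
  have hl : (0 : ℝ) ≤ l := l.cast_nonneg
  have hKpos : ∀ i, (0 : ℝ) < numBins l (H i) δ := fun i => by exact_mod_cast numBins_pos l (H i) δ
  have hK : 0 < ∏ i ∈ A, (numBins l (H i) δ : ℝ)⁻¹ :=
    Finset.prod_pos fun i _ => inv_pos.2 (hKpos i)
  have hsum : ∑ i ∈ A, H i + ∑ i ∈ Aᶜ, H i = ∑ i, H i := Finset.sum_add_sum_compl A H
  have hc : 0 ≤ ∑ i ∈ Aᶜ, H i := Finset.sum_nonneg fun i _ => hH i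
  have hq2 : (1 : ℝ) ≤ (q : ℝ) ^ 2 := one_le_pow₀ (by linarith)
  rw [max_mul_of_nonneg _ _ hK.le]
  refine max_le ?_ ?_
  · have hcard : (1 : ℝ) ≤ A.card := by exact_mod_cast hA.card_pos
    calc 1 * ∏ i ∈ A, (numBins l (H i) δ : ℝ)⁻¹ ≤ ∏ i ∈ A, (2 : ℝ) ^ (-(l * (H i + δ))) := by
          rw [one_mul]
          refine Finset.prod_le_prod (fun i _ => (inv_pos.2 (hKpos i)).le) fun i _ => ?_
          rw [Real.rpow_neg (by norm_num)]
          exact inv_anti₀ (by positivity) (rpow_le_numBins l (H i) δ)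
      _ = (2 : ℝ) ^ (-(l * (∑ i ∈ A, H i + A.card * δ))) := by
          rw [← Real.rpow_sum_of_pos (by norm_num), Finset.sum_neg_distrib, ← Finset.mul_sum,
            Finset.sum_add_distrib, Finset.sum_const, nsmul_eq_mul]
      _ ≤ (2 : ℝ) ^ (-(l * (H' - ∑ i ∈ Aᶜ, H i + δ))) := by
          refine Real.rpow_le_rpow_of_exponent_le (by norm_num) (neg_le_neg ?_)
          refine mul_le_mul_of_nonneg_left ?_ hl
          nlinarith
      _ ≤ _ := le_mul_of_one_le_left (by positivity) hq2
  · have h1 : (q : ℝ) ^ (∑ i ∈ A, indexLength q l (H i) δ) *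
        ∏ i ∈ A, (numBins l (H i) δ : ℝ)⁻¹ ≤ (q : ℝ) ^ 2 := by
      rw [← Finset.prod_pow_eq_pow_sum, ← Finset.prod_mul_distrib]
      calc _ ≤ ∏ _i ∈ A, (q : ℝ) := by
            refine Finset.prod_le_prod (fun i _ => by positivity) fun i _ => ?_
            rw [mul_inv_le_iff₀ (hKpos i)]
            exact pow_indexLength_le hq l (add_nonneg (hH i) hδ.le)
        _ = (q : ℝ) ^ A.card := by rw [Finset.prod_const]
        _ ≤ (q : ℝ) ^ 2 := pow_le_pow_right₀ (by linarith) (by simpa using Finset.card_le_univ A)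
    have h2 : (2 : ℝ) ^ (l * (H' - ∑ i ∈ Aᶜ, H i + δ)) ≤ (q : ℝ) ^ (b * R) := by
      rw [← rpow_div_logb hq, ← Real.rpow_natCast]
      refine Real.rpow_le_rpow_of_exponent_le (by linarith) ?_
      push_cast
      calc l * (H' - ∑ i ∈ Aᶜ, H i + δ) / Real.logb 2 q ≤ l * (H' + 2 * δ) / Real.logb 2 q := by
            gcongr <;> linarith
        _ = b * ((l : ℝ) / (b * Real.logb 2 q) * (H' + 2 * δ)) := by field_simp
        _ ≤ _ := by gcongr
    rw [div_mul_eq_mul_div, Real.rpow_neg (by norm_num), ← div_eq_mul_inv]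
    gcongr

/-- The probability, over the codebook, that a typical sequence is confused with another one. -/
theorem codebookLaw_exists_confusable_le {F : Type*} [Field F] [Finite F]
    {𝒳 : Fin 2 → Type*} [∀ i, Countable (𝒳 i)] [∀ i, MeasurableSpace (𝒳 i)]
    [∀ i, MeasurableSingletonClass (𝒳 i)] {P : Measure (∀ i, 𝒳 i)} [IsProbabilityMeasure P]
    (hP : FiniteEntropy P) {H : Fin 2 → ℝ} (hH : ∀ i, H i = entropy (P.map fun x => x i))
    {δ : ℝ} (hδ : 0 < δ) {l b R : ℕ} (hb : 0 < b)
    (hR : (l : ℝ) / (b * Real.logb 2 (Nat.card F)) * (entropy P + 2 * δ) ≤ R)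
    (lab : ∀ i, Fin (numBins l (H i) δ) ↪ (Fin (indexLength (Nat.card F) l (H i) δ) → F))
    {B : Set (Block (fun i => indexLength (Nat.card F) l (H i) δ) b → F)}
    (hB : ∀ A : Finset (Fin 2), A.Nonempty → FewSolutions R B A)
    {x : Fin l → ∀ i, 𝒳 i} (hx : x ∈ typicalSet P (δ / 4) l) :
    (codebookLaw 𝒳 l fun i => numBins l (H i) δ).real
      {cb | ∃ x' ∈ typicalSet P (δ / 4) l, x' ≠ x ∧
        Confusable B (fun i => lab i (cb i fun n => x n i)) fun i => lab i (cb i fun n => x' n i)} ≤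
      3 * (Nat.card F : ℝ) ^ 2 * ((2 : ℝ) ^ (-(δ / 2))) ^ l := by
  classical
  have hq : 2 ≤ Nat.card F := Finite.one_lt_card
  set S := (finite_typicalSet (P := P) (δ / 4) l).toFinset.erase x with hS
  set D : (Fin l → ∀ i, 𝒳 i) → Finset (Fin 2) := fun x' =>
    Finset.univ.filter fun i => (fun n => x n i) ≠ fun n => x' n i with hD
  have hDmem : ∀ x' i, i ∈ D x' ↔ (fun n => x n i) ≠ fun n => x' n i := fun x' i => by simp [hD]
  have hDne : ∀ x' ∈ S, (D x').Nonempty := by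
    intro x' hx'
    by_contra hne
    refine Finset.ne_of_mem_erase hx' ?_
    funext n i
    have : i ∉ D x' := by simp [Finset.not_nonempty_iff_eq_empty.1 hne]
    rw [hDmem, not_not] at this
    exact (congrFun this n).symm
  set β : Finset (Fin 2) → ℝ := fun A => (Nat.card F : ℝ) ^ 2 *
    (2 : ℝ) ^ (-(l * (entropy P - ∑ i ∈ Aᶜ, H i + δ)))
  have hterm : ∀ x' ∈ S, (codebookLaw 𝒳 l fun i => numBins l (H i) δ).real
      {cb | Confusable B (fun i => lab i (cb i fun n => x n i))
        fun i => lab i (cb i fun n => x' n i)} ≤ β (D x') := fun x' hx' =>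
    (codebookLaw_confusable_le hb lab (hB _ (hDne x' hx')) (hDmem x')).trans
      (confusion_bound hq hb (fun i => hH i ▸ entropy_nonneg _)
        (by simpa only [hH] using hP.entropy_le_sum) hδ hR (hDne x' hx'))
  -- Typicality with η = δ/4 inflates the number of competitors by 2^{lδ/2}; the binning slack
  -- 2^{-lδ} leaves 2^{-lδ/2}.
  have hfib : ∀ A : Finset (Fin 2), A.Nonempty →
      ∑ x' ∈ S with D x' = A, β A ≤ (Nat.card F : ℝ) ^ 2 * ((2 : ℝ) ^ (-(δ / 2))) ^ l := by
    intro A hA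
    rw [Finset.sum_const, nsmul_eq_mul]
    have hcard := card_differ_le (P := P) (η := δ / 4) (by positivity)
      (S := S.filter fun x' => D x' = A) (fun x' hx' => by
        simp only [Finset.coe_filter, hS, Finset.mem_erase, Set.Finite.mem_toFinset,
          Set.mem_ofPred_eq] at hx'
        exact hx'.1.2) hx hA (fun x' hx' i hi n => by
        have h1 := (Finset.mem_filter.1 hx').2
        rw [← h1, hDmem, not_not] at hi
        exact (congrFun hi n).symm)
    simp only [← hH] at hcard
    calc _ ≤ (2 : ℝ) ^ (l * (entropy P - ∑ i ∈ Aᶜ, H i + 2 * (δ / 4))) * β A := by gcongr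
      _ = (Nat.card F : ℝ) ^ 2 * ((2 : ℝ) ^ (l * (entropy P - ∑ i ∈ Aᶜ, H i + 2 * (δ / 4))) *
            (2 : ℝ) ^ (-(l * (entropy P - ∑ i ∈ Aᶜ, H i + δ)))) := by simp only [β]; ring
      _ = _ := by
          rw [← Real.rpow_add (by norm_num), ← Real.rpow_mul_natCast (by norm_num)]
          congr 2
          ring
  calc _ ≤ (codebookLaw 𝒳 l fun i => numBins l (H i) δ).real (⋃ x' ∈ S,
          {cb | Confusable B (fun i => lab i (cb i fun n => x n i))
            fun i => lab i (cb i fun n => x' n i)}) := by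
        refine measureReal_mono (fun cb hcb => ?_) (measure_ne_top _ _)
        obtain ⟨x', h1, h2, h3⟩ := hcb
        simp only [Set.mem_iUnion]
        exact ⟨x', by simp [hS, h1, h2], h3⟩
    _ ≤ ∑ x' ∈ S, β (D x') :=
        (measureReal_biUnion_finset_le _ _).trans (Finset.sum_le_sum hterm)
    -- Competitors are grouped by the set of messages in which they differ from x.
    _ = ∑ A ∈ (Finset.univ.erase ∅ : Finset (Finset (Fin 2))), ∑ x' ∈ S with D x' = A, β A := by
        rw [← Finset.sum_fiberwise_of_maps_to (t := Finset.univ.erase ∅) (g := D)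
          (fun x' hx' => by simpa using (hDne x' hx').ne_empty)]
        refine Finset.sum_congr rfl fun A _ => Finset.sum_congr rfl fun x' hx' => ?_
        rw [(Finset.mem_filter.1 hx').2]
    _ ≤ ∑ _A ∈ (Finset.univ.erase ∅ : Finset (Finset (Fin 2))),
          (Nat.card F : ℝ) ^ 2 * ((2 : ℝ) ^ (-(δ / 2))) ^ l :=
        Finset.sum_le_sum fun A hA => hfib A
          (Finset.nonempty_iff_ne_empty.2 (Finset.ne_of_mem_erase hA))
    _ = _ := by
        rw [Finset.sum_const, Finset.card_erase_of_mem (Finset.mem_univ _)]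
        simp
        ring

/-! ### Decoding -/

theorem prod_apply_le_of_forall_section_le {X Y : Type*} [MeasurableSpace X] [MeasurableSpace Y]
    {μ : Measure X} [IsProbabilityMeasure μ] {ν : Measure Y} [IsProbabilityMeasure ν]
    {S : Set (X × Y)} (hS : MeasurableSet S) {C : ℝ} (hC : 0 ≤ C)
    (h : ∀ x, ν.real (Prod.mk x ⁻¹' S) ≤ C) : (μ.prod ν).real S ≤ C := by
  refine ENNReal.toReal_le_of_le_ofReal hC ?_
  rw [Measure.prod_apply hS]
  calc ∫⁻ x, ν (Prod.mk x ⁻¹' S) ∂μ ≤ ∫⁻ _, ENNReal.ofReal C ∂μ :=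
        lintegral_mono fun x => (ENNReal.le_ofReal_iff_toReal_le (measure_ne_top _ _) hC).2 (h x)
    _ = ENNReal.ofReal C := by simp

section Decoding

variable {F : Type*} [Field F] {ι : Type*} [Fintype ι] {𝒳 : ι → Type*} {l : ℕ}
  {K h : ι → ℕ} {b : ℕ}

open Classical in
/-- The decoder that looks for an element of `S` that explains all packets. -/
def searchDecoder [Nonempty (∀ i, 𝒳 i)] (lab : ∀ i, Fin (K i) ↪ (Fin (h i) → F))
    (S : Set (Fin l → ∀ i, 𝒳 i)) : Decoder F 𝒳 l K h b := fun cb Q =>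
  if hx : ∃ x ∈ S, ∀ p ∈ Q, p = encode (fun i => lab i (cb i fun n => x n i)) p.1 then hx.choose
  -- This default is never reached when the true sequence lies in S, since it explains every packet.
  else fun _ => Classical.arbitrary _

theorem exists_confusable_of_decoding_error [Nonempty (∀ i, 𝒳 i)] [DecidableEq ι]
    {V : Type*} [Fintype V]
    (lab : ∀ i, Fin (K i) ↪ (Fin (h i) → F)) {S : Set (Fin l → ∀ i, 𝒳 i)} {src : ι → Set V}
    {N : ℕ} {ω : Outcome V F 𝒳 l K h b}
    (hω : ω ∉ allDecode src lab (searchDecoder lab S) N) (hS : ω.2.2.1 ∈ S) :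
    ∃ x' ∈ S, x' ≠ ω.2.2.1 ∧ Confusable (blindSpot ω.1 src ω.2.1 N)
      (fun i => lab i (ω.2.2.2 i fun n => ω.2.2.1 n i))
      fun i => lab i (ω.2.2.2 i fun n => x' n i) := by
  classical
  simp only [allDecode, Set.mem_ofPred_eq, not_forall] at hω
  obtain ⟨v, hv⟩ := hω
  set y := fun i => lab i (ω.2.2.2 i fun n => ω.2.2.1 n i) with hy
  have hex : ∃ x ∈ S, ∀ p ∈ stored ω.1 src ω.2.1 y N v,
      p = encode (fun i => lab i (ω.2.2.2 i fun n => x n i)) p.1 := by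
    refine ⟨ω.2.2.1, hS, fun p hp => ?_⟩
    rw [stored_eq_image] at hp
    obtain ⟨a, -, rfl⟩ := hp
    rfl
  rw [searchDecoder, dif_pos hex] at hv
  obtain ⟨h1, h2⟩ := hex.choose_spec
  -- The same node v witnesses all columns; `Confusable` would allow a different node for each,
  -- which only enlarges the bad event.
  refine ⟨hex.choose, h1, hv, fun r => ⟨v, fun p hp => ?_⟩⟩
  have hp' : encode y p.1 ∈ stored ω.1 src ω.2.1 y N v := by
    rw [stored_eq_image]
    exact ⟨_, ⟨p, hp, rfl⟩, rfl⟩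
  exact encode_eq_iff.1 (h2 _ hp').symm r

variable {V : Type*} [Fintype V] [Finite F] [MeasurableSpace F] [MeasurableSingletonClass F]
  [∀ i, Countable (𝒳 i)] [∀ i, MeasurableSpace (𝒳 i)] [∀ i, MeasurableSingletonClass (𝒳 i)]

theorem measurableSet_confusion [DecidableEq ι] (lab : ∀ i, Fin (K i) ↪ (Fin (h i) → F))
    {S : Set (Fin l → ∀ i, 𝒳 i)} (src : ι → Set V) (N : ℕ) (G : Set (Block h b → F) → Prop) :
    MeasurableSet {ω : ((ℕ → Set (V × V)) × Coeffs V F h b) × (Fin l → ∀ i, 𝒳 i) ×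
        Codebook 𝒳 l K | G (blindSpot ω.1.1 src ω.1.2 N) ∧ ω.2.1 ∈ S ∧
      ∃ x' ∈ S, x' ≠ ω.2.1 ∧ Confusable (blindSpot ω.1.1 src ω.1.2 N)
        (fun i => lab i (ω.2.2 i fun n => ω.2.1 n i))
        fun i => lab i (ω.2.2 i fun n => x' n i)} := by
  have heq : {ω : ((ℕ → Set (V × V)) × Coeffs V F h b) × (Fin l → ∀ i, 𝒳 i) ×
        Codebook 𝒳 l K | G (blindSpot ω.1.1 src ω.1.2 N) ∧ ω.2.1 ∈ S ∧
      ∃ x' ∈ S, x' ≠ ω.2.1 ∧ Confusable (blindSpot ω.1.1 src ω.1.2 N)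
        (fun i => lab i (ω.2.2 i fun n => ω.2.1 n i))
        fun i => lab i (ω.2.2 i fun n => x' n i)} =
      ⋃ x ∈ S, ⋃ x' ∈ S \ {x}, {ω | ω.2.1 = x} ∩
        (fun ω : ((ℕ → Set (V × V)) × Coeffs V F h b) × (Fin l → ∀ i, 𝒳 i) × Codebook 𝒳 l K =>
          (blindSpot ω.1.1 src ω.1.2 N, (fun i => ω.2.2 i fun n => x n i),
            fun i => ω.2.2 i fun n => x' n i)) ⁻¹'
          {p | G p.1 ∧ Confusable p.1 (fun i => lab i (p.2.1 i)) fun i => lab i (p.2.2 i)} := by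
    ext ω
    simp only [Set.mem_iUnion, Set.mem_inter_iff, Set.mem_preimage, Set.mem_ofPred_eq,
      exists_prop, Set.mem_sdiff, Set.mem_singleton_iff]
    constructor
    · rintro ⟨h1, h2, x', h3, h4, h5⟩
      exact ⟨_, h2, x', ⟨h3, h4⟩, rfl, h1, h5⟩
    · rintro ⟨x, h2, x', ⟨h3, h4⟩, rfl, h1, h5⟩
      exact ⟨h1, h2, x', h3, h4, h5⟩
  rw [heq]
  -- Sequences are countably many; for fixed x and x' only the blind spot and two tuples of bins
  -- matter, all with finite range.
  refine .biUnion (Set.to_countable _) fun x _ => .biUnion (Set.to_countable _) fun x' _ => ?_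
  refine (measurable_fst.comp measurable_snd (measurableSet_singleton x)).inter
    (Measurable.prodMk ((measurable_blindSpot src N id).comp measurable_fst)
      (Measurable.prodMk ?_ ?_) .of_discrete)
  all_goals
    refine measurable_pi_lambda _ fun i => ?_
    exact (measurable_pi_apply _).comp
      ((measurable_pi_apply i).comp (measurable_snd.comp measurable_snd))

end Decoding

end

end NetGossip

/-! ### Assembly of the error events -/

open NetGossip in
theorem mainTheorem3 {V : Type*} [Fintype V] (M : ObliviousModel V) (T α : ℝ) (hα : 0 < α)
    {F : Type*} [Field F] [Fintype F] [MeasurableSpace F] [MeasurableSingletonClass F]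
    (hM : M.FloodsWith T α (Fintype.card F))
    {𝒳 : Fin 2 → Type*} [∀ i, Countable (𝒳 i)] [∀ i, MeasurableSpace (𝒳 i)]
    [∀ i, MeasurableSingletonClass (𝒳 i)]
    (P : Measure (∀ i, 𝒳 i)) [IsProbabilityMeasure P] (hP : FiniteEntropy P)
    (H : Fin 2 → ℝ) (hH : ∀ i, H i = entropy (P.map fun x => x i))
    (ε : ℝ) (hε : 0 < ε) (δ : ℝ) (hδ : 0 < δ) :
    ∃ l₀ : ℕ, ∀ l : ℕ, l₀ ≤ l → ∀ b : ℕ, 0 < b → ∀ s : ℝ, s = b * Real.logb 2 (Fintype.card F) →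
      ∀ lab : ∀ i, Fin (numBins l (H i) δ) ↪ (Fin (indexLength (Fintype.card F) l (H i) δ) → F),
      ∃ D : Decoder F 𝒳 l (fun i => numBins l (H i) δ)
          (fun i => indexLength (Fintype.card F) l (H i) δ) b,
        ∀ src : Fin 2 → Set V, (∀ i, (src i).Nonempty) →
        ∀ N : ℕ, T + 1 / α * (⌈(l : ℝ) / s * (entropy P + 2 * δ)⌉ + Real.logb 2 ε⁻¹ + 3) ≤ N →
          (outcomeLaw M F P l (fun i => numBins l (H i) δ)
              (fun i => indexLength (Fintype.card F) l (H i) δ) b).real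
            (allDecode src lab D N)ᶜ ≤ ε := by
  classical
  have : Nonempty (∀ i, 𝒳 i) := nonempty_of_isProbabilityMeasure P
  have hq : 2 ≤ Nat.card F := Finite.one_lt_card
  generalize hqF : Fintype.card F = q at hM ⊢
  obtain rfl : q = Nat.card F := by rw [Nat.card_eq_fintype_card, hqF]
  have hr1 : (2 : ℝ) ^ (-(δ / 2)) < 1 :=
    Real.rpow_lt_one_of_one_lt_of_neg (by norm_num) (by linarith)
  -- Neither limit involves b, the labelling or the sources, so l₀ depends on none of them.
  have hlim := (tendsto_pow_atTop_nhds_zero_of_lt_one (by positivity) hr1).const_mul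
    (3 * (Nat.card F : ℝ) ^ 2)
  rw [mul_zero] at hlim
  have htyp := tendsto_prob_typicalSet_compl hP (show 0 < δ / 4 by positivity)
  have hε8 : (0 : ℝ) < ε / 8 := by positivity
  obtain ⟨l₀, hl₀⟩ := Filter.eventually_atTop.1
    ((hlim.eventually_le_const hε8).and (htyp.eventually_le_const hε8))
  refine ⟨l₀, fun l hl b hb s hs lab => ?_⟩
  obtain ⟨hl1, hl2⟩ := hl₀ l hl
  refine ⟨searchDecoder lab (typicalSet P (δ / 4) l), fun src hsrc N hN => ?_⟩
  have hout : IsProbabilityMeasure (outcomeLaw M F P l (fun i => numBins l (H i) δ)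
      (fun i => indexLength (Nat.card F) l (H i) δ) b) := by
    unfold outcomeLaw; infer_instance
  -- Excluding ε ≥ 1 makes log₂ ε⁻¹ nonnegative, so that the k used for flooding is positive.
  rcases le_or_gt 1 ε with hε1 | hε1
  · exact measureReal_le_one.trans hε1
  have hq' : (2 : ℝ) ≤ Nat.card F := by exact_mod_cast hq
  have hlog : 0 < Real.logb 2 (Nat.card F) := Real.logb_pos (by norm_num) (by linarith)
  have hb' : (0 : ℝ) < b := by exact_mod_cast hb
  have hs0 : 0 < s := by rw [hs]; positivity
  have hent : 0 ≤ entropy P := entropy_nonneg P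
  set R := ⌈(l : ℝ) / s * (entropy P + 2 * δ)⌉.toNat with hRdef
  have hR0 : 0 ≤ ⌈(l : ℝ) / s * (entropy P + 2 * δ)⌉ := Int.ceil_nonneg (by positivity)
  have hRc : ((⌈(l : ℝ) / s * (entropy P + 2 * δ)⌉ : ℤ) : ℝ) = R := by
    have : ((R : ℤ) : ℝ) = (⌈(l : ℝ) / s * (entropy P + 2 * δ)⌉ : ℤ) := by
      rw [hRdef, Int.toNat_of_nonneg hR0]
    rw [← this, Int.cast_natCast]
  have hR : (l : ℝ) / (b * Real.logb 2 (Nat.card F)) * (entropy P + 2 * δ) ≤ R := by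
    rw [← hs, ← hRc]
    exact Int.le_ceil _
  rw [hRc] at hN
  set L := Real.logb 2 ε⁻¹ with hL
  have hL0 : 0 ≤ L := Real.logb_nonneg (by norm_num) ((one_le_inv₀ hε).2 hε1.le)
  have hblind : ∀ μ : Block (fun i => indexLength (Nat.card F) l (H i) δ) b → F, μ ≠ 0 →
      (M.law.prod (coeffLaw V F (fun i => indexLength (Nat.card F) l (H i) δ) b)).real
        {ω | μ ∈ blindSpot ω.1 src ω.2 N} ≤ ε * ((Nat.card F : ℝ) ^ (R + 3))⁻¹ := by
    intro μ hμ
    refine (measure_mem_blindSpot_le M hM hsrc hμ (k := 1 / α * (R + L + 3)) (by positivity)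
      hN).trans ?_
    have h1 : -(α * (1 / α * (R + L + 3))) = -L + -((R + 3 : ℕ) : ℝ) := by
      push_cast; field_simp; ring
    rw [h1, Real.rpow_add (by linarith), Real.rpow_neg (by linarith) ((R + 3 : ℕ) : ℝ),
      Real.rpow_natCast]
    refine mul_le_mul_of_nonneg_right ?_ (by positivity)
    -- The base-2 logarithm suffices for every q, because q^{-L} ≤ 2^{-L} = ε.
    calc (Nat.card F : ℝ) ^ (-L) ≤ (2 : ℝ) ^ (-L) :=
          Real.rpow_le_rpow_of_nonpos (by norm_num) hq' (by linarith)
      _ = ε := by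
          rw [Real.rpow_neg (by norm_num), hL, Real.rpow_logb (by norm_num) (by norm_num)
            (by positivity), inv_inv]
  have hfew := prob_not_fewSolutions_le hb hε.le
    (fun μ => measurableSet_setOfPred.2 (measurable_blindSpot src N fun B => μ ∈ B)) hblind
  set ρ := M.law.prod (coeffLaw V F (fun i => indexLength (Nat.card F) l (H i) δ) b) with hρ
  set ν := (Measure.pi fun _ : Fin l => P).prod (codebookLaw 𝒳 l fun i => numBins l (H i) δ) with hν
  have hassoc : outcomeLaw M F P l (fun i => numBins l (H i) δ)
      (fun i => indexLength (Nat.card F) l (H i) δ) b =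
      (ρ.prod ν).map MeasurableEquiv.prodAssoc := by
    rw [outcomeLaw, hρ, Measure.prodAssoc_prod]
  set G : Set (Block (fun i => indexLength (Nat.card F) l (H i) δ) b → F) → Prop := fun B =>
    ∀ A : Finset (Fin 2), A.Nonempty → FewSolutions R B A
  set S₁ : Set (((ℕ → Set (V × V)) × Coeffs V F (fun i => indexLength (Nat.card F) l (H i) δ) b) ×
      (Fin l → ∀ i, 𝒳 i) × Codebook 𝒳 l fun i => numBins l (H i) δ) :=
    {ω | G (blindSpot ω.1.1 src ω.1.2 N) ∧ ω.2.1 ∈ typicalSet P (δ / 4) l ∧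
      ∃ x' ∈ typicalSet P (δ / 4) l, x' ≠ ω.2.1 ∧ Confusable (blindSpot ω.1.1 src ω.1.2 N)
        (fun i => lab i (ω.2.2 i fun n => ω.2.1 n i))
        fun i => lab i (ω.2.2 i fun n => x' n i)} with hS₁
  have hS₁m : MeasurableSet S₁ := measurableSet_confusion lab src N G
  have hS₁le : (ρ.prod ν).real S₁ ≤ ε / 8 := by
    refine prod_apply_le_of_forall_section_le hS₁m hε8.le fun ω => ?_
    refine prod_apply_le_of_forall_section_le (measurable_prodMk_left hS₁m) hε8.le fun x => ?_
    by_cases hx : G (blindSpot ω.1 src ω.2 N) ∧ x ∈ typicalSet P (δ / 4) l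
    · refine le_trans (measureReal_mono ?_ (measure_ne_top _ _))
        ((codebookLaw_exists_confusable_le hP hH hδ hb hR lab hx.1 hx.2).trans hl1)
      exact fun cb hcb => hcb.2.2
    · refine le_of_eq_of_le ?_ hε8.le
      rw [measureReal_eq_zero_iff (measure_ne_top _ _)]
      refine measure_mono_null (fun cb hcb => ?_) measure_empty
      exact hx ⟨hcb.1, hcb.2.1⟩
  have hsub : MeasurableEquiv.prodAssoc ⁻¹'
      (allDecode src lab (searchDecoder lab (typicalSet P (δ / 4) l)) N)ᶜ ⊆
      ({ω | ∃ A : Finset (Fin 2), A.Nonempty ∧ ¬ FewSolutions R (blindSpot ω.1 src ω.2 N) A} ×ˢ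
        Set.univ) ∪ (Set.univ ×ˢ ((typicalSet P (δ / 4) l)ᶜ ×ˢ Set.univ)) ∪ S₁ := by
    intro ω hω
    by_cases h1 : G (blindSpot ω.1.1 src ω.1.2 N)
    · by_cases h2 : ω.2.1 ∈ typicalSet P (δ / 4) l
      · exact Or.inr ⟨h1, h2, exists_confusable_of_decoding_error lab hω h2⟩
      · exact Or.inl (Or.inr ⟨trivial, h2, trivial⟩)
    · refine Or.inl (Or.inl ⟨?_, trivial⟩)
      simpa [G] using h1
  -- The decoding event is not shown to be measurable: transport along a measurable equivalence and
  -- monotonicity hold for arbitrary sets.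
  rw [hassoc, measureReal_def, MeasurableEquiv.map_apply, ← measureReal_def]
  refine (measureReal_mono hsub (measure_ne_top _ _)).trans ?_
  refine (measureReal_union_le _ _).trans ((add_le_add_left (measureReal_union_le _ _) _).trans ?_)
  rw [measureReal_prod_prod, measureReal_prod_prod, hν, measureReal_prod_prod, ← hν]
  simp only [probReal_univ, mul_one, one_mul]
  -- The budget is 3ε/4 for a bad blind spot, ε/8 for atypical samples and ε/8 for confusion.
  linarith
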